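/- Let $a,b>0$, $2\omega_1=-ib$, $2\omega_2=ab$, $\Omega=\omega_2/\omega_1=ia$, and set $$\theta(z|\Omega)=\sum_{n\in\mathbb Z}e^{\pi i n^2\Omega+2\pi i nz},\qquad \theta_{11}(z)=\sum_{n\in\mathbb Z}e^{\pi i\Omega(n+\frac12)^2+2\pi i(n+\frac12)(z+\frac12)},$$ $$F(z)=\log\theta_{11}\Bigl(\frac z{2\omega_1}\Bigr),\qquad F_k(z)=\frac{(-1)^{k-1}}{(k-1)!}F^{(k)}(z)\quad(k\ge1),$$ and define $q_{i,j}$ $(i,j\ge 1)$ by the Taylor expansion at $(0,0)$ $$\frac{\partial^2}{\partial z_1\partial z_2}\log\frac{\theta_{11}\left(\frac{z_2-z_1}{2\omega_1}\right)}{z_2-z_1}=\sum_{i,j\ge1}q_{i,j}z_1^{i-1}z_2^{j-1},\qquad q(t)=\sum_{i,j\ge1}q_{i,j}t_it_j .$$ For $t=(t_1,t_2,\dots)$ and $x=t_1$ let $\tau_0(t)=e^{\frac12q(t)}\theta\bigl(\frac{x}{2\omega_1}+e\,|\,\Omega\bigr)$ with $e\in\mathbb C$. Where the series $q(t)$ does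 not converge, $\tau_0(t)$ denotes the value at $\lambda=1$ of the (single-valued) analytic continuation of $\lambda\mapsto\tau_0(\lambda t_1,\lambda^2t_2,\lambda^3t_3,\dots)$ from a neighbourhood of $\lambda=0$ to a disc of radius $>1$ minus a relatively closed countable set not containing $0$ and $1$. Put $[\mu]=(\mu,\mu^2/2,\mu^3/3,\dots)$, $\eta(t,z)=\sum_{k\ge1}t_kz^k$, $\tilde\partial=(\partial_1,\partial_2/2,\partial_3/3,\dots)$ and let $$X(P,Q)=e^{\eta(t,P)-\eta(t,Q)}e^{-\eta(\tilde\partial,P^{-1})+\eta(\tilde\partial,Q^{-1})},\qquad\text{i.e. } (X(P,Q)f)(t)=e^{\eta(t,P)-\eta(t,Q)}f(t-[P^{-1}]+[Q^{-1}])$$ be the vertex operator, products being understood through $$X(P_1,Q_1)\cdots X(P_n,Q_n)=\prod_{k<l}\frac{(P_k-P_l)(Q_k-Q_l)}{(P_k-Q_l)(Q_k-P_l)}\;:X(P_1,Q_1)\cdots X(P_n,Q_n):$$ with normal ordering $:\ :$ (all shifts to the right). Let $M,N$ be nonnegative integers, $p_1,\dots,p_{N+M}\in\mathbb C$, $q_i=p_{N+i}$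 for $1\le i\le M$, with $\theta_{11}(p_i/2\omega_1)\ne0$ for all $i$ (equivalently $p_i\notin2\omega_1\mathbb Z+2\omega_2\mathbb Z$; in particular $p_i\neq 0$) and $q_i\ne p_j$ for $1\le i\le M$, $1\le j\le N$. Let $(a_{i,j})$ be a complex $M\times N$ matrix, $\Delta(x_1,\dots,x_n)=\prod_{i<j}(x_j-x_i)$, and $$\tau(t)=\Delta(p_1^{-1},\dots,p_N^{-1})\,e^{\sum_{j=1}^N\eta(t,p_j^{-1})}\,e^{\sum_{i,j}a_{i,j}X(q_i^{-1},p_j^{-1})}\,\tau_0\Bigl(t-\sum_{j=1}^N[p_j]\Bigr).$$ Let $B=(b_{i,j})$ be the $(N+M)\times N$ matrix with $b_{i,j}=\delta_{i,j}$ for $i\le N$ and $b_{N+i,j}=a_{i,j}\prod_{m\ne j}\frac{p_j^{-1}-p_m^{-1}}{q_i^{-1}-p_m^{-1}}$. For $I=\{i_1<\dots<i_N\}\subset\{1,\dots,N+M\}$ let $B_I=\det(b_{i_r,s})_{1\le r,s\le N}$ and $$C_I=\prod_{j\in I}\frac{p_j}{\theta_{11}\left(\frac{p_j}{2\omega_1}\right)^N}\prod_{j,k\in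 I,\,j<k}\theta_{11}\Bigl(\frac{p_k-p_j}{2\omega_1}\Bigr).$$ **Proposition.** There are constants $c\ne0$ and $c_1,c_2,\dots\in\mathbb C$, depending only on $a,b,N$, such that for all $M$, $(p_i)$, $(a_{i,j})$, $e$ as above and all $t$ for which $\sum_k|t_k|r^k<\infty$ for every $r>0$ (e.g. all $t$ with finitely many nonzero entries): the series $q(t)$, $\sum_jc_jt_j$ and $\sum_kt_kF_k(p_i)$ converge absolutely, the values $\tau_0(t)$ and $\tau_0(t-\sum_{i\in I}[p_i])$ exist, the first being given by the series expression, and $$\tau(t)=c\,e^{\sum_{j\ge1}c_jt_j+\frac12q(t)}\sum_IB_IC_I\,e^{\sum_{j\in I}\sum_{k\ge1}t_kF_k(p_j)}\,\theta\Bigl(\frac{x-\sum_{j\in I}p_j}{2\omega_1}+e\,\Big|\,\Omega\Bigr).$$ -/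

import Mathlib

open Filter Topology Finset

noncomputable section

namespace EllipticKP

/-! ### Time variables and vertex operators -/

/-- The KP times `t = (t₁, t₂, t₃, …)`. -/
abbrev Times := ℕ+ → ℂ

/-- The times for which `η(t, z) = ∑ tₖ zᵏ` converges for every complex `z`
(in particular all sequences with finitely many nonzero entries). -/
def IsEntireTimes (t : Times) : Prop :=
  ∀ r : ℝ, Summable fun k : ℕ+ => ‖t k‖ * r ^ (k : ℕ)

/-- `[μ] = (μ, μ²/2, μ³/3, …)`. -/
def miwa (μ : ℂ) : Times := fun k => μ ^ (k : ℕ) / (k : ℕ)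

/-- `η(t, z) = ∑ₖ tₖ zᵏ`. -/
def eta (t : Times) (z : ℂ) : ℂ := ∑' k : ℕ+, t k * z ^ (k : ℕ)

/-- The vertex operator `X(P, Q) = e^{η(t,P) - η(t,Q)} e^{-η(∂̃,P⁻¹) + η(∂̃,Q⁻¹)}` with
`∂̃ = (∂₁, ∂₂/2, ∂₃/3, …)`; the second factor is the shift `t ↦ t - [P⁻¹] + [Q⁻¹]`. -/
def vertexOp (P Q : ℂ) (f : Times → ℂ) (t : Times) : ℂ :=
  Complex.exp (eta t P - eta t Q) * f (t - miwa P⁻¹ + miwa Q⁻¹)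

/-- The normal ordered product `: X(P₁,Q₁) ⋯ X(Pₙ,Qₙ) :`, all shifts acting first. -/
def normalOrdered {n : ℕ} (P Q : Fin n → ℂ) (f : Times → ℂ) (t : Times) : ℂ :=
  Complex.exp (∑ k, (eta t (P k) - eta t (Q k))) *
    f (t - ∑ k, miwa (P k)⁻¹ + ∑ k, miwa (Q k)⁻¹)

/-- The scalar `∏_{k<l} (P_k - P_l)(Q_k - Q_l) / ((P_k - Q_l)(Q_k - P_l))`. -/
def vertexCoeff {n : ℕ} (P Q : Fin n → ℂ) : ℂ :=
  ∏ k, ∏ l ∈ Ioi k, ((P k - P l) * (Q k - Q l)) / ((P k - Q l) * (Q k - P l))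

/-- The product `X(P₁,Q₁) ⋯ X(Pₙ,Qₙ)`. For general parameters the iterated operator is a divergent
series; as usual the product is the rational continuation in the parameters of the composition,
i.e. `vertexCoeff` times the normal ordered product. See `vertexProd_one` and `vertexProd_two`
for the agreement with the composition where the latter converges. -/
def vertexProd {n : ℕ} (P Q : Fin n → ℂ) (f : Times → ℂ) (t : Times) : ℂ :=
  vertexCoeff P Q * normalOrdered P Q f t

/-- `exp (∑_{i,j} A_{ij} X(P_i, Q_j))`, i.e. `∑ₙ (1/n!) (∑_{i,j} A_{ij} X(P_i,Q_j))ⁿ` with the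
`n`-th power multiplied out. -/
def expVertex {M N : ℕ} (A : Matrix (Fin M) (Fin N) ℂ) (P : Fin M → ℂ) (Q : Fin N → ℂ)
    (f : Times → ℂ) (t : Times) : ℂ :=
  ∑' n : ℕ, (1 / (n.factorial : ℂ)) * ∑ w : Fin n → Fin M × Fin N,
    (∏ k, A (w k).1 (w k).2) *
      vertexProd (fun k => P (w k).1) (fun k => Q (w k).2) f t

theorem vertexProd_one (P Q : ℂ) (f : Times → ℂ) (t : Times) :
    vertexProd (n := 1) ![P] ![Q] f t = vertexOp P Q f t := by
  simp [vertexProd, vertexCoeff, normalOrdered, vertexOp]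

theorem hasSum_eta_miwa {x z : ℂ} (h : ‖x * z‖ < 1) :
    HasSum (fun k : ℕ+ => miwa x k * z ^ (k : ℕ)) (-Complex.log (1 - x * z)) := by
  have h1 := Complex.hasSum_taylorSeries_neg_log h
  have h2 : HasSum (fun k : ℕ+ => (x * z) ^ (k : ℕ) / ((k : ℕ) : ℂ))
      (-Complex.log (1 - x * z)) := by
    refine (PNat.coe_injective.hasSum_iff ?_).2 h1
    intro n hn
    have : n = 0 := by
      by_contra h0
      exact hn ⟨⟨n, Nat.pos_of_ne_zero h0⟩, rfl⟩
    simp [this]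
  refine h2.congr_fun ?_ |> fun h => h
  intro k
  simp only [miwa, mul_pow]
  ring

theorem IsEntireTimes.summable_eta {t : Times} (ht : IsEntireTimes t) (z : ℂ) :
    Summable fun k : ℕ+ => t k * z ^ (k : ℕ) := by
  refine Summable.of_norm ?_
  simpa [norm_mul, norm_pow] using ht ‖z‖

theorem exp_eta_shift {t : Times} (ht : IsEntireTimes t) {P Q z : ℂ}
    (hP : ‖z‖ < ‖P‖) (hQ : ‖z‖ < ‖Q‖) :
    Complex.exp (eta (t - miwa P⁻¹ + miwa Q⁻¹) z) =
      Complex.exp (eta t z) * ((1 - P⁻¹ * z) / (1 - Q⁻¹ * z)) := by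
  have key : ∀ R : ℂ, ‖z‖ < ‖R‖ → ‖R⁻¹ * z‖ < 1 := by
    intro R hR
    have hR0 : 0 < ‖R‖ := lt_of_le_of_lt (norm_nonneg z) hR
    rw [norm_mul, norm_inv, inv_mul_lt_iff₀ hR0]
    simpa using hR
  have ne : ∀ R : ℂ, ‖z‖ < ‖R‖ → 1 - R⁻¹ * z ≠ 0 := by
    intro R hR h0
    have h1 := key R hR
    have h2 : R⁻¹ * z = 1 := (sub_eq_zero.1 h0).symm
    rw [h2] at h1
    simp at h1
  have h := (((ht.summable_eta z).hasSum.sub (hasSum_eta_miwa (key P hP))).add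
    (hasSum_eta_miwa (key Q hQ))).tsum_eq
  have h' : eta (t - miwa P⁻¹ + miwa Q⁻¹) z =
      eta t z - -Complex.log (1 - P⁻¹ * z) + -Complex.log (1 - Q⁻¹ * z) := by
    refine Eq.trans ?_ h
    unfold eta
    refine tsum_congr fun k => ?_
    simp only [Pi.add_apply, Pi.sub_apply]
    ring
  rw [h', sub_neg_eq_add, Complex.exp_add, Complex.exp_add, Complex.exp_neg,
    Complex.exp_log (ne P hP), Complex.exp_log (ne Q hQ)]
  ring

/-- Where the composition of two vertex operators converges, it is the product defined above. -/
theorem vertexProd_two {t : Times} (ht : IsEntireTimes t) {P₁ Q₁ P₂ Q₂ : ℂ}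
    (h₁ : ‖P₂‖ < ‖P₁‖) (h₂ : ‖Q₂‖ < ‖P₁‖) (h₃ : ‖P₂‖ < ‖Q₁‖) (h₄ : ‖Q₂‖ < ‖Q₁‖)
    (f : Times → ℂ) :
    vertexOp P₁ Q₁ (vertexOp P₂ Q₂ f) t = vertexProd ![P₁, P₂] ![Q₁, Q₂] f t := by
  have e1 := exp_eta_shift ht h₁ h₃
  have e2 := exp_eta_shift ht h₂ h₄
  have hP : P₁ ≠ 0 := norm_pos_iff.1 (lt_of_le_of_lt (norm_nonneg _) h₁)
  have hQ : Q₁ ≠ 0 := norm_pos_iff.1 (lt_of_le_of_lt (norm_nonneg _) h₃)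
  have a1 : P₁ - Q₂ ≠ 0 := fun h => by rw [sub_eq_zero.1 h] at h₂; exact lt_irrefl _ h₂
  have a2 : Q₁ - P₂ ≠ 0 := fun h => by rw [sub_eq_zero.1 h] at h₃; exact lt_irrefl _ h₃
  have hs : t - miwa P₁⁻¹ + miwa Q₁⁻¹ - miwa P₂⁻¹ + miwa Q₂⁻¹ =
      t - (miwa P₁⁻¹ + miwa P₂⁻¹) + (miwa Q₁⁻¹ + miwa Q₂⁻¹) := by abel
  have hI : (Ioi (0 : Fin 2)) = {1} := by decide
  have hI' : (Ioi (1 : Fin 2)) = ∅ := by decide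
  have hc : (1 - P₁⁻¹ * P₂) / (1 - Q₁⁻¹ * P₂) / ((1 - P₁⁻¹ * Q₂) / (1 - Q₁⁻¹ * Q₂)) =
      ((P₁ - P₂) * (Q₁ - Q₂)) / ((P₁ - Q₂) * (Q₁ - P₂)) := by
    have b1 : 1 - P₁⁻¹ * P₂ = (P₁ - P₂) / P₁ := by field_simp
    have b2 : 1 - Q₁⁻¹ * P₂ = (Q₁ - P₂) / Q₁ := by field_simp
    have b3 : 1 - P₁⁻¹ * Q₂ = (P₁ - Q₂) / P₁ := by field_simp
    have b4 : 1 - Q₁⁻¹ * Q₂ = (Q₁ - Q₂) / Q₁ := by field_simp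
    rw [b1, b2, b3, b4]
    field_simp
  simp only [vertexOp, vertexProd, vertexCoeff, normalOrdered, Fin.prod_univ_two,
    Fin.sum_univ_two, hI, hI', Finset.prod_singleton, Finset.prod_empty, mul_one,
    Matrix.cons_val_zero, Matrix.cons_val_one, hs]
  rw [Complex.exp_sub (eta (t - miwa P₁⁻¹ + miwa Q₁⁻¹) P₂), e1, e2, ← hc, Complex.exp_add,
    Complex.exp_sub (eta t P₂)]
  have := Complex.exp_ne_zero (eta t Q₂)
  field_simp

/-! ### Genus one data: `2ω₁ = -ib`, `2ω₂ = ab`, `Ω = ω₂/ω₁ = ia` -/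

/-- `2ω₁ = -ib`. -/
def twoω₁ (b : ℝ) : ℂ := -(Complex.I * b)

/-- `2ω₂ = ab`. -/
def twoω₂ (a b : ℝ) : ℂ := (a : ℂ) * b

/-- `Ω = ω₂ / ω₁`. -/
def modulus (a b : ℝ) : ℂ := twoω₂ a b / twoω₁ b

theorem modulus_eq (a : ℝ) {b : ℝ} (hb : 0 < b) : modulus a b = Complex.I * a := by
  have hb' : (b : ℂ) ≠ 0 := by exact_mod_cast hb.ne'
  have : -(Complex.I * (b : ℂ)) ≠ 0 := neg_ne_zero.2 (mul_ne_zero Complex.I_ne_zero hb')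
  rw [modulus, twoω₁, twoω₂, div_eq_iff this]
  linear_combination ((a : ℂ) * b) * Complex.I_mul_I

/-- Riemann's theta function `θ(z|Ω) = ∑_{n ∈ ℤ} exp(πi n²Ω + 2πi n z)` in genus one. -/
def theta (a b : ℝ) (z : ℂ) : ℂ := jacobiTheta₂ z (modulus a b)

/-- `θ₁₁(z|Ω) = ∑_{n ∈ ℤ} exp(πi Ω (n+1/2)² + 2πi (n+1/2)(z+1/2))`. -/
def theta11 (a b : ℝ) (z : ℂ) : ℂ :=
  ∑' n : ℤ, Complex.exp (Real.pi * Complex.I * modulus a b * ((n : ℂ) + 1 / 2) ^ 2 +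
    2 * Real.pi * Complex.I * ((n : ℂ) + 1 / 2) * (z + 1 / 2))

/-- `F'(z)` for `F(z) = log θ₁₁(z / 2ω₁)`, independent of the branch of the logarithm. -/
def dlogTheta (a b : ℝ) (z : ℂ) : ℂ := logDeriv (fun w => theta11 a b (w / twoω₁ b)) z

/-- `F_j(z) = (-1)^{j-1} / (j-1)! · F^{(j)}(z)` for `j ≥ 1`. -/
def Fcoef (a b : ℝ) (j : ℕ+) (z : ℂ) : ℂ :=
  (-1) ^ ((j : ℕ) - 1) / (((j : ℕ) - 1).factorial : ℂ) *
    iteratedDeriv ((j : ℕ) - 1) (dlogTheta a b) z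

/-- `u ↦ θ₁₁(u / 2ω₁) / u`, with its removable singularity at `u = 0` filled in
(note `θ₁₁(0) = 0`). -/
def thetaQuot (a b : ℝ) : ℂ → ℂ := dslope (fun u => theta11 a b (u / twoω₁ b)) 0

/-- `∂² / ∂z₁∂z₂ log (θ₁₁((z₂ - z₁) / 2ω₁) / (z₂ - z₁))`; the inner `z₂`-derivative of the
logarithm is a logarithmic derivative, so no branch has to be chosen. -/
def bidiff (a b : ℝ) (z₁ z₂ : ℂ) : ℂ :=
  deriv (fun w₁ => logDeriv (fun w₂ => thetaQuot a b (w₂ - w₁)) z₂) z₁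

/-- The coefficient `q_{ij}` of `z₁^{i-1} z₂^{j-1}` in the Taylor expansion of `bidiff`
at `(0, 0)`. -/
def qcoef (a b : ℝ) (i j : ℕ+) : ℂ :=
  iteratedDeriv ((i : ℕ) - 1)
    (fun z₁ => iteratedDeriv ((j : ℕ) - 1) (fun z₂ => bidiff a b z₁ z₂) 0) 0 /
    ((((i : ℕ) - 1).factorial : ℂ) * (((j : ℕ) - 1).factorial : ℂ))

/-- The series `q(t) = ∑_{i,j} q_{ij} tᵢ tⱼ` converges absolutely. -/
def QSummable (a b : ℝ) (t : Times) : Prop :=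
  Summable fun ij : ℕ+ × ℕ+ => qcoef a b ij.1 ij.2 * t ij.1 * t ij.2

/-- `q(t) = ∑_{i,j} q_{ij} tᵢ tⱼ`. -/
def qform (a b : ℝ) (t : Times) : ℂ :=
  ∑' ij : ℕ+ × ℕ+, qcoef a b ij.1 ij.2 * t ij.1 * t ij.2

/-- The series expression `e^{q(t)/2} θ(t₁ / 2ω₁ + e | Ω)` of the seed `τ₀`. -/
def tauSeries (a b : ℝ) (e : ℂ) (t : Times) : ℂ :=
  Complex.exp (qform a b t / 2) * theta a b (t 1 / twoω₁ b + e)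

/-- The weighted dilation `λ · t = (λ t₁, λ² t₂, λ³ t₃, …)`. It sends `[μ]` to `[λ μ]`. -/
def dilate (l : ℂ) (t : Times) : Times := fun k => l ^ (k : ℕ) * t k

/-- `v` is the value at `t` of the seed `τ₀`: the series `e^{q/2} θ` converges at `λ · t`
for small `λ`, and its analytic continuation in `λ` takes the value `v` at `λ = 1`.
The continuation is required on a disc of radius `> 1` with a relatively closed countable set
of singular points (not containing `0` and `1`) removed. -/
def IsTauValue (a b : ℝ) (e : ℂ) (t : Times) (v : ℂ) : Prop :=
  ∃ (r : ℝ) (S : Set ℂ) (φ : ℂ → ℂ), 1 < r ∧ S.Countable ∧ (0 : ℂ) ∉ S ∧ (1 : ℂ) ∉ S ∧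
    IsOpen (Metric.ball (0 : ℂ) r \ S) ∧ DifferentiableOn ℂ φ (Metric.ball (0 : ℂ) r \ S) ∧
    (∀ᶠ l in 𝓝 (0 : ℂ), QSummable a b (dilate l t) ∧ φ l = tauSeries a b e (dilate l t)) ∧
    φ 1 = v

/-- A countable set can be avoided on a connected set joining `0` and `1` in the unit disc. -/
theorem exists_connected_avoiding {S : Set ℂ} (hS : S.Countable) (h0 : (0 : ℂ) ∉ S)
    (h1 : (1 : ℂ) ∉ S) {r : ℝ} (hr : 1 < r) :
    ∃ U : Set ℂ, IsPreconnected U ∧ (0 : ℂ) ∈ U ∧ (1 : ℂ) ∈ U ∧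
      U ⊆ Metric.ball (0 : ℂ) r \ S := by
  set B : Set ℝ := (fun s : ℂ => s.im / (2 * s.re)) '' S ∪
    (fun s : ℂ => s.im / (2 * (1 - s.re))) '' S with hB
  have hBc : B.Countable := (hS.image _).union (hS.image _)
  obtain ⟨y, hy, hyB⟩ : ∃ y ∈ Set.Ioo (0 : ℝ) (1 / 2), y ∈ Bᶜ := by
    obtain ⟨y, hy, hyB⟩ := (hBc.dense_compl ℝ).inter_open_nonempty _ (isOpen_Ioo (a := (0 : ℝ))
      (b := 1 / 2)) ⟨1 / 4, by norm_num, by norm_num⟩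
    exact ⟨y, hy, hyB⟩
  set c : ℂ := ⟨1 / 2, y⟩ with hc
  have hcn : ‖c‖ ≤ 1 := by
    refine (Complex.norm_le_abs_re_add_abs_im c).trans ?_
    have e1 : |c.re| = 1 / 2 := by simp [hc]
    have e2 : |c.im| = y := by simp [hc, abs_of_pos hy.1]
    rw [e1, e2]
    linarith [hy.2]
  have conv : Convex ℝ (Metric.ball (0 : ℂ) r) := convex_ball _ _
  have m0 : (0 : ℂ) ∈ Metric.ball (0 : ℂ) r := by
    simpa using lt_trans zero_lt_one hr
  have m1 : (1 : ℂ) ∈ Metric.ball (0 : ℂ) r := by simpa using hr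
  have mc : c ∈ Metric.ball (0 : ℂ) r := by simpa using lt_of_le_of_lt hcn hr
  refine ⟨segment ℝ 0 c ∪ segment ℝ 1 c, ?_, Or.inl (left_mem_segment ℝ _ _),
    Or.inr (left_mem_segment ℝ _ _), ?_⟩
  · exact (convex_segment _ _).isPreconnected.union c (right_mem_segment ℝ _ _)
      (right_mem_segment ℝ _ _) (convex_segment _ _).isPreconnected
  · rintro s (hs | hs)
    · refine ⟨conv.segment_subset m0 mc hs, fun hsS => ?_⟩
      obtain ⟨u, v, hu, hv, huv, rfl⟩ := hs
      rcases hv.eq_or_lt with rfl | hv'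
      · simp at hsS
        exact h0 hsS
      · refine hyB (Or.inl ⟨_, hsS, ?_⟩)
        simp [hc]
        field_simp
    · refine ⟨conv.segment_subset m1 mc hs, fun hsS => ?_⟩
      obtain ⟨u, v, hu, hv, huv, rfl⟩ := hs
      rcases hv.eq_or_lt with rfl | hv'
      · have : u = 1 := by linarith
        subst this
        simp at hsS
        exact h1 hsS
      · refine hyB (Or.inr ⟨_, hsS, ?_⟩)
        have hu' : u = 1 - v := by linarith
        subst hu'
        have e1 : (((1 : ℝ) - v) • (1 : ℂ) + v • c).im = v * y := by simp [hc]
        have e2 : (((1 : ℝ) - v) • (1 : ℂ) + v • c).re = 1 - v / 2 := by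
          simp [hc]
          ring
        have e3 : 2 * (1 - (1 - v / 2)) = v := by ring
        simp only [e1, e2, e3]
        field_simp

/-- The value of the seed is unique. -/
theorem IsTauValue.unique {a b : ℝ} {e : ℂ} {t : Times} {v w : ℂ}
    (hv : IsTauValue a b e t v) (hw : IsTauValue a b e t w) : v = w := by
  obtain ⟨r, S, φ, hr, hS, h0, h1, ho, hφ, hφt, rfl⟩ := hv
  obtain ⟨r', S', ψ, hr', hS', h0', h1', ho', hψ, hψt, rfl⟩ := hw
  obtain ⟨U, hU, hU0, hU1, hUs⟩ := exists_connected_avoiding (hS.union hS')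
    (by simp [h0, h0']) (by simp [h1, h1']) (lt_min hr hr')
  have s1 : U ⊆ Metric.ball (0 : ℂ) r \ S := fun z hz =>
    ⟨Metric.ball_subset_ball (min_le_left _ _) (hUs hz).1, fun h => (hUs hz).2 (Or.inl h)⟩
  have s2 : U ⊆ Metric.ball (0 : ℂ) r' \ S' := fun z hz =>
    ⟨Metric.ball_subset_ball (min_le_right _ _) (hUs hz).1, fun h => (hUs hz).2 (Or.inr h)⟩
  refine AnalyticOnNhd.eqOn_of_preconnected_of_eventuallyEq
    ((hφ.analyticOnNhd ho).mono s1) ((hψ.analyticOnNhd ho').mono s2) hU hU0 ?_ hU1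
  filter_upwards [hφt, hψt] with l hl hl'
  rw [hl.2, hl'.2]

/-- Where the series converges (on a dilation by some `r > 1`), the value is that of the series. -/
theorem isTauValue_tauSeries {a b : ℝ} (ha : 0 < a) (hb : 0 < b) (e : ℂ) {t : Times} {r : ℝ}
    (hr : 1 < r) (ht : QSummable a b (dilate r t)) :
    IsTauValue a b e t (tauSeries a b e t) := by
  set u : ℕ+ × ℕ+ → ℝ := fun ij =>
    ‖qcoef a b ij.1 ij.2 * dilate r t ij.1 * dilate r t ij.2‖ with hu
  have hus : Summable u := ht.norm
  have hbd : ∀ (ij : ℕ+ × ℕ+) (l : ℂ), l ∈ Metric.ball (0 : ℂ) r →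
      ‖qcoef a b ij.1 ij.2 * dilate l t ij.1 * dilate l t ij.2‖ ≤ u ij := by
    intro ij l hl
    have hl' : ‖l‖ ≤ ‖(r : ℂ)‖ := by
      rw [Complex.norm_real, Real.norm_of_nonneg (by linarith)]
      simpa using (mem_ball_zero_iff.1 hl).le
    simp only [hu, dilate, norm_mul, norm_pow]
    gcongr
  have hsum : ∀ l ∈ Metric.ball (0 : ℂ) r, QSummable a b (dilate l t) := fun l hl =>
    Summable.of_norm_bounded hus fun ij => hbd ij l hl
  have hd : DifferentiableOn ℂ (fun l => qform a b (dilate l t)) (Metric.ball (0 : ℂ) r) := by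
    refine Complex.differentiableOn_tsum_of_summable_norm hus (fun ij => ?_) Metric.isOpen_ball hbd
    simp only [dilate]
    fun_prop
  have hm : 0 < (modulus a b).im := by simp [modulus_eq a hb, ha]
  have hθ : Differentiable ℂ (theta a b) := fun z => differentiableAt_jacobiTheta₂_fst z hm
  have hone : dilate 1 t = t := by
    funext k
    simp [dilate]
  refine ⟨r, ∅, fun l => tauSeries a b e (dilate l t), hr, Set.countable_empty, by simp, by simp,
    by simp, ?_, ?_, by simp only [hone]⟩
  · rw [Set.sdiff_empty]
    unfold tauSeries
    refine DifferentiableOn.mul (by fun_prop) ?_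
    refine (hθ.comp (f := fun l => dilate l t 1 / twoω₁ b + e) ?_).differentiableOn
    simp only [dilate]
    fun_prop
  · filter_upwards [Metric.ball_mem_nhds (0 : ℂ) (zero_lt_one.trans hr)] with l hl
    exact ⟨hsum l hl, rfl⟩

open Classical in
/-- The seed `τ₀(t) = e^{q(t)/2} θ(t₁ / 2ω₁ + e | Ω)`, continued analytically as in `IsTauValue`
(and `0` where there is no continuation). -/
def tau0 (a b : ℝ) (e : ℂ) (t : Times) : ℂ :=
  if h : ∃ v, IsTauValue a b e t v then h.choose else 0

theorem IsTauValue.tau0_eq {a b : ℝ} {e : ℂ} {t : Times} {v : ℂ}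
    (hv : IsTauValue a b e t v) : tau0 a b e t = v := by
  have h : ∃ v, IsTauValue a b e t v := ⟨v, hv⟩
  rw [tau0, dif_pos h]
  exact h.choose_spec.unique hv

/-! ### The dressed tau function -/

/-- `Δ(x₁, …, xₙ) = ∏_{i<j} (x_j - x_i)`. -/
def vdm {n : ℕ} (x : Fin n → ℂ) : ℂ := ∏ i, ∏ j ∈ Ioi i, (x j - x i)

/-- `p₁, …, p_N` among `p₁, …, p_{N+M}`. -/
def pPart {N M : ℕ} (p : Fin (N + M) → ℂ) (j : Fin N) : ℂ := p (Fin.castAdd M j)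

/-- `q_i = p_{N+i}`. -/
def qPart {N M : ℕ} (p : Fin (N + M) → ℂ) (i : Fin M) : ℂ := p (Fin.natAdd N i)

/-- `τ(t) = Δ(p₁⁻¹,…,p_N⁻¹) e^{∑ⱼ η(t,pⱼ⁻¹)} G τ₀(t - ∑ⱼ [pⱼ])` with
`G = exp(∑_{i,j} a_{ij} X(q_i⁻¹, p_j⁻¹))`, where `q_i = p_{N+i}`. -/
def tauVO (a b : ℝ) (e : ℂ) {N M : ℕ} (p : Fin (N + M) → ℂ) (A : Matrix (Fin M) (Fin N) ℂ)
    (t : Times) : ℂ :=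
  vdm (fun j => (pPart p j)⁻¹) * Complex.exp (∑ j, eta t (pPart p j)⁻¹) *
    expVertex A (fun i => (qPart p i)⁻¹) (fun j => (pPart p j)⁻¹)
      (fun s => tau0 a b e (s - ∑ j, miwa (pPart p j))) t

/-- The `(N+M) × N` matrix with top block the identity and
`b_{N+i,j} = a_{ij} ∏_{m ≠ j} (p_j⁻¹ - p_m⁻¹) / (q_i⁻¹ - p_m⁻¹)`. -/
def Bmat {N M : ℕ} (p : Fin (N + M) → ℂ) (A : Matrix (Fin M) (Fin N) ℂ) :
    Matrix (Fin (N + M)) (Fin N) ℂ :=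
  Matrix.of fun r j => Fin.addCases (motive := fun _ => ℂ)
    (fun i => if i = j then 1 else 0)
    (fun i => A i j * ∏ m ∈ univ.erase j,
      ((pPart p j)⁻¹ - (pPart p m)⁻¹) / ((qPart p i)⁻¹ - (pPart p m)⁻¹)) r

/-- The index sets `I = (i₁ < ⋯ < i_N)` in `{1, …, N+M}`. -/
def indexSets (N M : ℕ) : Finset (Fin N → Fin (N + M)) :=
  univ.filter fun I => ∀ r s, r < s → I r < I s

/-- The minor `B_I = det (b_{i_r, s})`. -/
def minorB {N M : ℕ} (p : Fin (N + M) → ℂ) (A : Matrix (Fin M) (Fin N) ℂ)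
    (I : Fin N → Fin (N + M)) : ℂ :=
  ((Bmat p A).submatrix I id).det

/-- `C_I = ∏_{j ∈ I} p_j / θ₁₁(p_j/2ω₁)^N · ∏_{j<k in I} θ₁₁((p_k - p_j)/2ω₁)`. -/
def Ccoef (a b : ℝ) {N M : ℕ} (p : Fin (N + M) → ℂ) (I : Fin N → Fin (N + M)) : ℂ :=
  (∏ r, p (I r) / theta11 a b (p (I r) / twoω₁ b) ^ N) *
    ∏ r, ∏ s ∈ Ioi r, theta11 a b ((p (I s) - p (I r)) / twoω₁ b)

end EllipticKP

end

namespace EllipticKP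

/-! ### Vandermonde products -/

/-! The argument has an algebraic half and an analytic half, joined through `dressedTerm`: a
Vandermonde product in the inverse nodes, times the exponential of the `eta` terms, times the seed
at the times shifted by the chosen nodes.

Algebra. A product of vertex operators with a repeated `p_j` has coefficient zero, so the
exponential is a finite sum over partial maps from columns to the `q_i`: each map is spelled by `n!`
words, which cancels `1/n!`. The coefficient of a word times the Vandermonde product of the `p_j⁻¹`
equals a product of entries of `B` times the Vandermonde product of the new nodes
(`vdm_mul_vertexCoeff`). Since `dressedTerm` is alternating in its nodes, a Cauchy–Binet expansion
collects the sum into maximal minors of `B` (`tauVO_eq_sum_minorB`).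

Analysis. Put `E(u) = θ₁₁(u/2ω₁)/u` and `L = E'/E`. The form `q` is built from the Taylor
coefficients of `L'` at `0`. Hence `q(t,[w])` is a combination of differences of derivatives of `L`
at `0` and at `w`, and `exp q([z],[w]) = E(w-z)E(0)/(E(z)E(w))`. This gives the seed at `t - ∑[x_r]`
in closed form for small `x_r`. The closed form, dilated by `λ`, is holomorphic off the countable
set where some `E(λx_r)` vanishes, so it is the required continuation (`isTauValue_sub_sum`).
Finally the Vandermonde product of inverses turns the `E` into `θ₁₁`, the `eta` terms turn the
coefficients of `L` into `F_k` (`Fcoef_eq`), and the leftovers at `0` form `c` and the `c_k`.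

Everything rests on `E(0) ≠ 0`, i.e. `θ₁₁'(0) ≠ 0`, proved by a series estimate for `a ≥ 1` and by
modular inversion for `a ≤ 1`. -/

theorem vdm_eq_det {n : ℕ} (x : Fin n → ℂ) : vdm x = (Matrix.vandermonde x).det := by
  rw [vdm, Matrix.det_vandermonde]

theorem vdm_comp_perm {n : ℕ} (x : Fin n → ℂ) (σ : Equiv.Perm (Fin n)) :
    vdm (x ∘ σ) = (Equiv.Perm.sign σ : ℤ) * vdm x := by
  rw [vdm_eq_det, vdm_eq_det, ← Matrix.det_permute]
  rfl

theorem vdm_eq_zero {n : ℕ} {x : Fin n → ℂ} {i j : Fin n} (hij : i ≠ j) (h : x i = x j) :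
    vdm x = 0 := by
  rw [vdm_eq_det]
  refine Matrix.det_zero_of_row_eq hij ?_
  funext k
  simp [Matrix.vandermonde_apply, h]

/-- Isolates the factors that involve the node `j`. The sign comes from reversing the differences
with the nodes above `j`; the last factor is independent of `x j`, which is what `vdm_update` uses.
-/
theorem vdm_split {n : ℕ} (x : Fin n → ℂ) (j : Fin n) :
    vdm x = ((-1) ^ #(Ioi j) * ∏ m ∈ univ.erase j, (x j - x m)) *
      ∏ i ∈ univ.erase j, ∏ k ∈ (Ioi i).erase j, (x k - x i) := by
  have h1 : vdm x = (∏ k ∈ Ioi j, (x k - x j)) *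
      ∏ i ∈ univ.erase j, ∏ k ∈ Ioi i, (x k - x i) := by
    rw [vdm, ← mul_prod_erase univ _ (mem_univ j)]
  have h2 : ∏ i ∈ univ.erase j, ∏ k ∈ Ioi i, (x k - x i) =
      (∏ i ∈ Iio j, (x j - x i)) *
        ∏ i ∈ univ.erase j, ∏ k ∈ (Ioi i).erase j, (x k - x i) := by
    have h3 : ∏ i ∈ Iio j, (x j - x i) =
        ∏ i ∈ univ.erase j, if i < j then x j - x i else 1 := by
      rw [← prod_filter]
      refine prod_congr ?_ fun _ _ => rfl
      ext i
      simp only [mem_Iio, mem_filter, mem_erase, mem_univ, and_true]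
      exact ⟨fun h => ⟨h.ne, h⟩, fun h => h.2⟩
    rw [h3, ← prod_mul_distrib]
    refine prod_congr rfl fun i hi => ?_
    split_ifs with hij
    · rw [mul_prod_erase _ (fun k => x k - x i) (mem_Ioi.2 hij)]
    · rw [one_mul, erase_eq_of_notMem (by simpa using hij)]
  have h4 : ∏ m ∈ univ.erase j, (x j - x m) =
      (∏ m ∈ Iio j, (x j - x m)) * ∏ m ∈ Ioi j, (x j - x m) := by
    rw [← prod_union]
    · refine prod_congr ?_ fun _ _ => rfl
      ext i
      simp [lt_or_lt_iff_ne]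
    · rw [Finset.disjoint_left]
      intro i h1 h2
      exact lt_asymm (mem_Iio.1 h1) (mem_Ioi.1 h2)
  have h5 : ∏ m ∈ Ioi j, (x m - x j) = (-1) ^ #(Ioi j) * ∏ m ∈ Ioi j, (x j - x m) := by
    rw [← prod_const, ← prod_mul_distrib]
    exact prod_congr rfl fun _ _ => by ring
  rw [h1, h2, h4, h5]
  ring

/-- Replacing one node in a Vandermonde product. -/
theorem vdm_update {n : ℕ} (x : Fin n → ℂ) (j : Fin n) (y : ℂ) :
    vdm (Function.update x j y) * ∏ m ∈ univ.erase j, (x j - x m) =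
      vdm x * ∏ m ∈ univ.erase j, (y - x m) := by
  rw [vdm_split x j, vdm_split (Function.update x j y) j]
  have e1 : ∏ m ∈ univ.erase j, (Function.update x j y j - Function.update x j y m) =
      ∏ m ∈ univ.erase j, (y - x m) := by
    refine prod_congr rfl fun m hm => ?_
    rw [Function.update_self, Function.update_of_ne (ne_of_mem_erase hm)]
  have e2 : ∏ i ∈ univ.erase j, ∏ k ∈ (Ioi i).erase j,
      (Function.update x j y k - Function.update x j y i) =
      ∏ i ∈ univ.erase j, ∏ k ∈ (Ioi i).erase j, (x k - x i) := by
    refine prod_congr rfl fun i hi => prod_congr rfl fun k hk => ?_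
    rw [Function.update_of_ne (ne_of_mem_erase hi), Function.update_of_ne (ne_of_mem_erase hk)]
  rw [e1, e2]
  ring

/-! ### Sums over minors -/

theorem strictMono_of_mem_indexSets {N M : ℕ} {I : Fin N → Fin (N + M)}
    (hI : I ∈ indexSets N M) : StrictMono I := fun r s h => (mem_filter.1 hI).2 r s h

/-- A Cauchy–Binet type expansion: pairing the maximal minors with an alternating function. -/
theorem sum_minor_mul_alternating {N M : ℕ} (B : Matrix (Fin (N + M)) (Fin N) ℂ)
    (Φ : (Fin N → Fin (N + M)) → ℂ)
    (hperm : ∀ f (σ : Equiv.Perm (Fin N)), Φ (f ∘ σ) = (Equiv.Perm.sign σ : ℤ) * Φ f)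
    (hzero : ∀ f, ¬ Function.Injective f → Φ f = 0) :
    ∑ I ∈ indexSets N M, (B.submatrix I id).det * Φ I = ∑ f, (∏ s, B (f s) s) * Φ f := by
  have hL : ∑ I ∈ indexSets N M, (B.submatrix I id).det * Φ I =
      ∑ x ∈ indexSets N M ×ˢ (univ : Finset (Equiv.Perm (Fin N))),
        (∏ s, B (x.1 (x.2 s)) s) * Φ (x.1 ∘ x.2) := by
    rw [sum_product]
    refine sum_congr rfl fun I _ => ?_
    rw [Matrix.det_apply', sum_mul]
    refine sum_congr rfl fun σ _ => ?_
    rw [hperm]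
    simp only [Matrix.submatrix_apply, id]
    ring
  have hR : ∑ f, (∏ s, B (f s) s) * Φ f =
      ∑ f ∈ univ.filter (fun f : Fin N → Fin (N + M) => Function.Injective f),
        (∏ s, B (f s) s) * Φ f := by
    rw [sum_filter]
    refine sum_congr rfl fun f _ => ?_
    split_ifs with h
    · rfl
    · rw [hzero f h, mul_zero]
  rw [hL, hR]
  -- Every injective map is uniquely an increasing map followed by a reordering of its arguments;
  -- sorting recovers the pair.
  refine sum_bij (fun x _ => x.1 ∘ x.2) ?_ ?_ ?_ fun _ _ => rfl
  · rintro ⟨I, σ⟩ hx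
    have hI := strictMono_of_mem_indexSets (mem_product.1 hx).1
    exact mem_filter.2 ⟨mem_univ _, hI.injective.comp σ.injective⟩
  · rintro ⟨I, σ⟩ hx ⟨J, τ⟩ hy h
    have hI := strictMono_of_mem_indexSets (mem_product.1 hx).1
    have hJ := strictMono_of_mem_indexSets (mem_product.1 hy).1
    have hr : Set.range I = Set.range J := by
      rw [← EquivLike.range_comp I σ, ← EquivLike.range_comp J τ]
      exact congrArg Set.range h
    have hIJ : I = J := (StrictMono.range_inj hI hJ).1 hr
    subst hIJ
    have : σ = τ := by
      ext s
      have := congrFun h s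
      exact congrArg _ (hI.injective this)
    rw [this]
  · intro f hf
    have hf' : Function.Injective f := (mem_filter.1 hf).2
    refine ⟨(f ∘ Tuple.sort f, (Tuple.sort f)⁻¹), ?_, ?_⟩
    · refine mem_product.2 ⟨mem_filter.2 ⟨mem_univ _, fun r s h => ?_⟩, mem_univ _⟩
      exact (Tuple.monotone_sort f).strictMono_of_injective
        (hf'.comp (Tuple.sort f).injective) h
    · funext s
      simp

/-! ### Words and partial maps -/

/-- The word `w`, with distinct second letters, spells the partial map `g`. -/
def Spells {n M N : ℕ} (w : Fin n → Fin M × Fin N) (g : Fin N → Option (Fin M)) : Prop :=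
  Function.Injective (fun k => (w k).2) ∧ (∀ k, g (w k).2 = some (w k).1) ∧
    ∀ s, (∀ k, (w k).2 ≠ s) → g s = none

/-- The inductive step for words: dropping the first letter frees its column, because no later
letter uses that column. -/
theorem Spells.tail {n M N : ℕ} {w : Fin (n + 1) → Fin M × Fin N} {g : Fin N → Option (Fin M)}
    (h : Spells w g) :
    Spells (fun k : Fin n => w k.succ) (Function.update g (w 0).2 none) := by
  obtain ⟨hi, hs, hn⟩ := h
  refine ⟨fun k l hkl => Fin.succ_injective _ (hi hkl), fun k => ?_, fun s hs' => ?_⟩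
  · rw [Function.update_of_ne, hs]
    intro h
    exact Fin.succ_ne_zero k (hi h)
  · by_cases h : s = (w 0).2
    · rw [h, Function.update_self]
    · rw [Function.update_of_ne h]
      refine hn s fun k => ?_
      refine Fin.cases ?_ ?_ k
      · exact fun h' => h h'.symm
      · exact hs'

theorem Spells.unique {n M N : ℕ} {w : Fin n → Fin M × Fin N} {g g' : Fin N → Option (Fin M)}
    (h : Spells w g) (h' : Spells w g') : g = g' := by
  funext s
  by_cases hs : ∃ k, (w k).2 = s
  · obtain ⟨k, rfl⟩ := hs
    rw [h.2.1, h'.2.1]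
  · push Not at hs
    rw [h.2.2 s hs, h'.2.2 s hs]

theorem exists_spells {n M N : ℕ} {w : Fin n → Fin M × Fin N}
    (h : Function.Injective fun k => (w k).2) : ∃ g, Spells w g := by
  classical
  refine ⟨fun s => if hs : ∃ k, (w k).2 = s then some (w hs.choose).1 else none, h, fun k => ?_,
    fun s hs => ?_⟩
  · have hk : ∃ l, (w l).2 = (w k).2 := ⟨k, rfl⟩
    have := h hk.choose_spec
    simp only [dif_pos hk, this]
  · refine dif_neg ?_
    push Not
    exact hs

-- A word spelling `g` is exactly an enumeration of the domain of `g`, the first letters being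
-- forced by `g`.
open Classical in
theorem card_spells {M N : ℕ} (n : ℕ) (g : Fin N → Option (Fin M)) :
    #(univ.filter fun w : Fin n → Fin M × Fin N => Spells w g) =
      if n = #(univ.filter fun s => (g s).isSome) then n.factorial else 0 := by
  have e : {w : Fin n → Fin M × Fin N // Spells w g} ≃ (Fin n ≃ {s // (g s).isSome}) :=
    { toFun := fun w => Equiv.ofBijective
        (fun k => ⟨(w.1 k).2, by rw [w.2.2.1]; rfl⟩)
        ⟨fun k l h => w.2.1 (congrArg Subtype.val h), fun s => by
          by_contra! h
          have := w.2.2.2 s.1 fun k hk => h k (Subtype.ext hk)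
          have h2 := s.2
          rw [this] at h2
          simp at h2⟩
      invFun := fun e => ⟨fun k => ((g (e k)).get (e k).2, (e k).1),
        fun k l h => e.injective (Subtype.ext h), fun k => by simp, fun s hs => by
          by_contra h
          have h' : (g s).isSome := Option.isSome_iff_ne_none.2 h
          exact hs (e.symm ⟨s, h'⟩) (by simp)⟩
      left_inv := fun w => by
        ext k
        · exact congrArg Fin.val (Option.get_of_eq_some _ (w.2.2.1 k))
        · rfl
      right_inv := fun e => by
        ext k
        rfl }
  rw [← Fintype.card_subtype, Fintype.card_congr e]
  split_ifs with h
  · have e' : Fin n ≃ {s // (g s).isSome} := Fintype.equivOfCardEq (by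
      rw [Fintype.card_fin, Fintype.card_subtype, ← h])
    rw [Fintype.card_equiv e', Fintype.card_fin]
  · rw [Fintype.card_eq_zero_iff]
    refine ⟨fun e' => h ?_⟩
    have := Fintype.card_congr e'
    rwa [Fintype.card_fin, Fintype.card_subtype] at this

/-- An exponential sum over words is a sum over partial maps. -/
theorem tsum_words {M N : ℕ} (T : ∀ n, (Fin n → Fin M × Fin N) → ℂ)
    (U : (Fin N → Option (Fin M)) → ℂ)
    (hT : ∀ n (w : Fin n → Fin M × Fin N), ¬ Function.Injective (fun k => (w k).2) → T n w = 0)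
    (hU : ∀ n (w : Fin n → Fin M × Fin N) g, Spells w g → T n w = U g) :
    ∑' n : ℕ, (1 / (n.factorial : ℂ)) * ∑ w, T n w = ∑ g, U g := by
  classical
  have h1 : ∀ n, ∑ w, T n w = ∑ g, (if n = #(univ.filter fun s => (g s).isSome) then
      (n.factorial : ℂ) else 0) * U g := by
    intro n
    have h2 : ∀ w : Fin n → Fin M × Fin N, T n w = ∑ g, if Spells w g then U g else 0 := by
      intro w
      by_cases hw : Function.Injective fun k => (w k).2
      · obtain ⟨g, hg⟩ := exists_spells hw
        rw [sum_eq_single g, if_pos hg, hU n w g hg]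
        · intro g' _ hne
          exact if_neg fun h => hne (h.unique hg)
        · simp
      · rw [hT n w hw]
        refine (sum_eq_zero fun g _ => if_neg fun h => hw h.1).symm
    rw [sum_congr rfl fun w _ => h2 w, sum_comm]
    refine sum_congr rfl fun g _ => ?_
    rw [← sum_filter, sum_const, card_spells, nsmul_eq_mul]
    congr 1
    split_ifs <;> simp
  -- Second letters are distinct elements of `Fin N`, so words longer than `N` contribute nothing
  -- and the series is finite.
  have h3 : ∀ n : ℕ, n ∉ range (N + 1) → (1 / (n.factorial : ℂ)) * ∑ w, T n w = 0 := by
    intro n hn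
    rw [h1, sum_eq_zero, mul_zero]
    intro g _
    rw [if_neg, zero_mul]
    rintro rfl
    refine hn (mem_range.2 (Nat.lt_succ_of_le ?_))
    simpa using card_le_univ (univ.filter fun s => (g s).isSome)
  rw [tsum_eq_sum h3, sum_congr rfl fun n _ => by rw [h1, mul_sum], sum_comm]
  refine sum_congr rfl fun g _ => ?_
  have hm : #(univ.filter fun s => (g s).isSome) ∈ range (N + 1) :=
    mem_range.2 (Nat.lt_succ_of_le
      (by simpa using card_le_univ (univ.filter fun s => (g s).isSome)))
  rw [sum_eq_single_of_mem _ hm]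
  · rw [if_pos rfl, ← mul_assoc, one_div, inv_mul_cancel₀, one_mul]
    exact_mod_cast Nat.factorial_ne_zero _
  · intro n _ hne
    rw [if_neg hne, zero_mul, mul_zero]

/-- The row indices selected by a partial map: `s` is kept or replaced by `N + i`. -/
def selectRow {M N : ℕ} (g : Fin N → Option (Fin M)) (s : Fin N) : Fin (N + M) :=
  (g s).elim (Fin.castAdd M s) (Fin.natAdd N)

theorem Spells.selectRow_apply {n M N : ℕ} {w : Fin n → Fin M × Fin N}
    {g : Fin N → Option (Fin M)} (h : Spells w g) (k : Fin n) :
    selectRow g (w k).2 = Fin.natAdd N (w k).1 := by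
  rw [selectRow, h.2.1]
  rfl

theorem Spells.selectRow_of_notMem {n M N : ℕ} {w : Fin n → Fin M × Fin N}
    {g : Fin N → Option (Fin M)} (h : Spells w g) {s : Fin N} (hs : ∀ k, (w k).2 ≠ s) :
    selectRow g s = Fin.castAdd M s := by
  rw [selectRow, h.2.2 s hs]
  rfl

/-- Columns outside the word keep their own row, where `H` is normalised to `1`, so only the letters
of the word contribute. -/
theorem Spells.prod_selectRow {n M N : ℕ} {w : Fin n → Fin M × Fin N}
    {g : Fin N → Option (Fin M)} (h : Spells w g) {α : Type*} [CommMonoid α]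
    (H : Fin N → Fin (N + M) → α) (hH : ∀ s, H s (Fin.castAdd M s) = 1) :
    ∏ s, H s (selectRow g s) = ∏ k, H (w k).2 (Fin.natAdd N (w k).1) := by
  symm
  refine Fintype.prod_of_injective _ h.1 _ _ (fun s hs => ?_) fun k => ?_
  · rw [h.selectRow_of_notMem (fun k hk => hs ⟨k, hk⟩), hH]
  · rw [h.selectRow_apply]

theorem Spells.sum_selectRow {n M N : ℕ} {w : Fin n → Fin M × Fin N}
    {g : Fin N → Option (Fin M)} (h : Spells w g) {α : Type*} [AddCommGroup α]
    (H : Fin (N + M) → α) :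
    ∑ s, H (selectRow g s) = ∑ s, H (Fin.castAdd M s) +
      (∑ k, H (Fin.natAdd N (w k).1) - ∑ k, H (Fin.castAdd M (w k).2)) := by
  rw [← sub_eq_iff_eq_add', ← sum_sub_distrib, ← sum_sub_distrib]
  symm
  refine Fintype.sum_of_injective _ h.1 _
    (fun s => H (selectRow g s) - H (Fin.castAdd M s)) (fun s hs => ?_) fun k => ?_
  · simp only [h.selectRow_of_notMem (fun k hk => hs ⟨k, hk⟩), sub_self]
  · simp only [h.selectRow_apply]

/-! ### The scalar coefficient of a product of vertex operators -/

theorem vertexCoeff_succ {n : ℕ} (P Q : Fin (n + 1) → ℂ) :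
    vertexCoeff P Q = (∏ l : Fin n, ((P 0 - P l.succ) * (Q 0 - Q l.succ)) /
      ((P 0 - Q l.succ) * (Q 0 - P l.succ))) *
        vertexCoeff (fun k => P k.succ) (fun k => Q k.succ) := by
  unfold vertexCoeff
  rw [Fin.prod_univ_succ]
  congr 1
  · rw [Fin.prod_Ioi_zero]
  · refine prod_congr rfl fun k _ => ?_
    rw [Fin.prod_Ioi_succ]

/-- The vertex operator coefficient of a word as a quotient of Vandermonde products. -/
theorem vdm_mul_vertexCoeff {M N : ℕ} (x : Fin (N + M) → ℂ)
    (hx : ∀ i j, x (Fin.natAdd N i) ≠ x (Fin.castAdd M j)) :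
    ∀ (n : ℕ) (w : Fin n → Fin M × Fin N) (g : Fin N → Option (Fin M)), Spells w g →
    vdm (fun s => x (Fin.castAdd M s)) * vertexCoeff (fun k => x (Fin.natAdd N (w k).1))
      (fun k => x (Fin.castAdd M (w k).2)) =
    (∏ k, ∏ m ∈ univ.erase (w k).2, (x (Fin.castAdd M (w k).2) - x (Fin.castAdd M m)) /
      (x (Fin.natAdd N (w k).1) - x (Fin.castAdd M m))) * vdm (fun s => x (selectRow g s)) := by
  intro n
  induction n with
  | zero =>
    intro w g h
    have : selectRow g = Fin.castAdd M := by
      funext s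
      exact h.selectRow_of_notMem fun k => k.elim0
    simp [this, vertexCoeff]
  | succ n ih =>
    intro w g h
    have ht := h.tail
    have hih := ih _ _ ht
    set g' := Function.update g (w 0).2 none with hg'
    set y : Fin N → ℂ := fun s => x (selectRow g' s) with hy
    set P := x (Fin.natAdd N (w 0).1) with hP
    set Q := x (Fin.castAdd M (w 0).2) with hQ
    have hyj : y (w 0).2 = Q := by simp [hy, selectRow, hg', hQ]
    have hupd : (fun s => x (selectRow g s)) = Function.update y (w 0).2 P := by
      funext s
      by_cases hs : s = (w 0).2
      · rw [hs, Function.update_self, h.selectRow_apply]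
      · rw [Function.update_of_ne hs, hy, hg']
        simp only [selectRow, Function.update_of_ne hs]
    -- `y` lists the nodes after the tail of the word has acted. Column `(w 0).2` still carries `Q`,
    -- and the first letter replaces it by `P`.
    have key := vdm_update y (w 0).2 P
    rw [hyj] at key
    -- products over the remaining nodes of `y`
    have hprod : ∀ Z : ℂ, (∏ m ∈ univ.erase (w 0).2, (Z - y m)) *
        ∏ l : Fin n, (Z - x (Fin.castAdd M (w l.succ).2)) =
        (∏ m ∈ univ.erase (w 0).2, (Z - x (Fin.castAdd M m))) *
          ∏ l : Fin n, (Z - x (Fin.natAdd N (w l.succ).1)) := by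
      intro Z
      have hsplit : ∀ u : Fin N → ℂ, ∏ m ∈ univ.erase (w 0).2, (Z - u m) =
          (∏ l : Fin n, (Z - u (w l.succ).2)) *
          ∏ m ∈ (univ.erase (w 0).2) \ (univ.image fun l : Fin n => (w l.succ).2),
            (Z - u m) := by
        intro u
        have hsub : (univ.image fun l : Fin n => (w l.succ).2) ⊆ univ.erase (w 0).2 := by
          intro s hs
          obtain ⟨l, -, rfl⟩ := mem_image.1 hs
          exact mem_erase.2 ⟨fun h' => Fin.succ_ne_zero l (h.1 h'), mem_univ _⟩
        rw [← prod_sdiff hsub, mul_comm, prod_image]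
        intro l _ l' _ hl
        exact ht.1 hl
      rw [hsplit y, hsplit]
      have e1 : ∀ l : Fin n, y (w l.succ).2 = x (Fin.natAdd N (w l.succ).1) := fun l => by
        rw [hy]
        simp only
        rw [ht.selectRow_apply l]
      have e2 : ∏ m ∈ (univ.erase (w 0).2) \ (univ.image fun l : Fin n => (w l.succ).2),
          (Z - y m) = ∏ m ∈ (univ.erase (w 0).2) \ (univ.image fun l : Fin n => (w l.succ).2),
          (Z - x (Fin.castAdd M m)) := by
        refine prod_congr rfl fun m hm => ?_
        have hm' := (mem_sdiff.1 hm).2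
        rw [hy]
        simp only
        rw [ht.selectRow_of_notMem fun k hk => hm' (mem_image.2 ⟨k, mem_univ _, hk⟩)]
      rw [e2, prod_congr rfl fun l _ => by rw [e1 l]]
      ring
    have hp1 := hprod P
    have hp2 := hprod Q
    rw [vertexCoeff_succ, Fin.prod_univ_succ, hupd, prod_div_distrib, prod_mul_distrib,
      prod_mul_distrib, prod_div_distrib]
    have n1 : ∏ m ∈ univ.erase (w 0).2, (P - x (Fin.castAdd M m)) ≠ 0 :=
      prod_ne_zero_iff.2 fun m _ => sub_ne_zero.2 (hx _ _)
    have n2 : ∏ l : Fin n, (P - x (Fin.castAdd M (w l.succ).2)) ≠ 0 :=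
      prod_ne_zero_iff.2 fun l _ => sub_ne_zero.2 (hx _ _)
    have n3 : ∏ l : Fin n, (Q - x (Fin.natAdd N (w l.succ).1)) ≠ 0 :=
      prod_ne_zero_iff.2 fun l _ => sub_ne_zero.2 (hx _ _).symm
    generalize ∏ m ∈ univ.erase (w 0).2, (P - x (Fin.castAdd M m)) = a₁ at *
    generalize ∏ m ∈ univ.erase (w 0).2, (Q - x (Fin.castAdd M m)) = a₂ at *
    rw [mul_assoc (a₂ / a₁)]
    rw [div_mul_eq_mul_div, div_mul_eq_mul_div, mul_div_assoc', div_eq_div_iff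
      (mul_ne_zero n2 n3) n1]
    rw [← hP, ← hQ]
    generalize (∏ k : Fin n, ∏ m ∈ univ.erase (w k.succ).2,
      (x (Fin.castAdd M (w k.succ).2) - x (Fin.castAdd M m)) /
        (x (Fin.natAdd N (w k.succ).1) - x (Fin.castAdd M m))) = D at *
    generalize ∏ l : Fin n, (P - x (Fin.castAdd M (w l.succ).2)) = c₁ at *
    generalize ∏ l : Fin n, (Q - x (Fin.natAdd N (w l.succ).1)) = c₂ at *
    generalize ∏ l : Fin n, (P - x (Fin.natAdd N (w l.succ).1)) = d₁ at *
    generalize ∏ l : Fin n, (Q - x (Fin.castAdd M (w l.succ).2)) = d₂ at *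
    linear_combination a₁ * d₁ * d₂ * hih + D * vdm (Function.update y (w 0).2 P) * c₁ * hp2 -
      D * c₁ * d₂ * key - D * vdm y * d₂ * hp1

/-- The dressed function before summation: the term of `tauVO` with nodes `p ∘ f`. -/
noncomputable def dressedTerm (a b : ℝ) (e : ℂ) {N M : ℕ} (p : Fin (N + M) → ℂ) (t : Times)
    (f : Fin N → Fin (N + M)) : ℂ :=
  vdm (fun s => (p (f s))⁻¹) * Complex.exp (∑ s, eta t (p (f s))⁻¹) *
    tau0 a b e (t - ∑ s, miwa (p (f s)))

theorem dressedTerm_perm (a b : ℝ) (e : ℂ) {N M : ℕ} (p : Fin (N + M) → ℂ) (t : Times)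
    (f : Fin N → Fin (N + M)) (σ : Equiv.Perm (Fin N)) :
    dressedTerm a b e p t (f ∘ σ) = (Equiv.Perm.sign σ : ℤ) * dressedTerm a b e p t f := by
  have h := vdm_comp_perm (fun s => (p (f s))⁻¹) σ
  have h1 := Equiv.sum_comp σ fun s => eta t (p (f s))⁻¹
  have h2 := Equiv.sum_comp σ fun s => miwa (p (f s))
  simp only [dressedTerm, Function.comp_def] at h ⊢
  rw [h, h1, h2]
  ring

theorem dressedTerm_eq_zero (a b : ℝ) (e : ℂ) {N M : ℕ} (p : Fin (N + M) → ℂ) (t : Times)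
    (f : Fin N → Fin (N + M)) (hf : ¬ Function.Injective f) :
    dressedTerm a b e p t f = 0 := by
  simp only [Function.Injective, not_forall] at hf
  obtain ⟨r, s, h, hne⟩ := hf
  rw [dressedTerm, vdm_eq_zero hne (by rw [h]), zero_mul, zero_mul]

theorem selectRow_injective {N M : ℕ} :
    Function.Injective fun g : Fin N → Option (Fin M) => selectRow g := by
  intro g g' h
  funext s
  have hs : selectRow g s = selectRow g' s := congrFun h s
  have hv := congrArg Fin.val hs
  unfold selectRow at hv
  rcases hg : g s with _ | i <;> rcases hg' : g' s with _ | i' <;>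
    simp only [hg, hg', Option.elim_none, Option.elim_some, Fin.val_castAdd, Fin.val_natAdd] at hv
  · rfl
  · omega
  · omega
  · exact congrArg some (Fin.ext (by omega))

theorem Bmat_castAdd {N M : ℕ} (p : Fin (N + M) → ℂ) (A : Matrix (Fin M) (Fin N) ℂ)
    (i j : Fin N) : Bmat p A (Fin.castAdd M i) j = if i = j then 1 else 0 := by
  simp [Bmat]

theorem Bmat_natAdd {N M : ℕ} (p : Fin (N + M) → ℂ) (A : Matrix (Fin M) (Fin N) ℂ)
    (i : Fin M) (j : Fin N) : Bmat p A (Fin.natAdd N i) j =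
      A i j * ∏ m ∈ univ.erase j,
        ((pPart p j)⁻¹ - (pPart p m)⁻¹) / ((qPart p i)⁻¹ - (pPart p m)⁻¹) := by
  simp [Bmat]

/-- The product of the entries of `B` along `f` vanishes unless `f` comes from a partial map. -/
theorem sum_prod_Bmat {N M : ℕ} (p : Fin (N + M) → ℂ) (A : Matrix (Fin M) (Fin N) ℂ)
    (Φ : (Fin N → Fin (N + M)) → ℂ) :
    ∑ f, (∏ s, Bmat p A (f s) s) * Φ f =
      ∑ g : Fin N → Option (Fin M), (∏ s, Bmat p A (selectRow g s) s) * Φ (selectRow g) := by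
  symm
  refine Fintype.sum_of_injective _ selectRow_injective _ _ (fun f hf => ?_) fun _ => rfl
  -- In the identity block only diagonal entries survive; a map avoiding the off-diagonal ones is
  -- precisely a `selectRow g`.
  suffices h : ∃ s i, f s = Fin.castAdd M i ∧ i ≠ s by
    obtain ⟨s, i, hs, hi⟩ := h
    rw [prod_eq_zero (mem_univ s), zero_mul]
    rw [hs, Bmat_castAdd, if_neg hi]
  by_contra! h
  refine hf ⟨fun s => Fin.addCases (motive := fun _ => Option (Fin M)) (fun _ => none) some (f s),
    funext fun s => ?_⟩
  show selectRow _ s = f s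
  unfold selectRow
  generalize hr : f s = r
  induction r using Fin.addCases with
  | left i =>
    have := h s i hr
    subst this
    beta_reduce
    rw [hr]
    simp
  | right i =>
    beta_reduce
    rw [hr]
    simp

/-- The dressed tau function as a sum over the maximal minors of `B`. -/
theorem tauVO_eq_sum_minorB (a b : ℝ) (e : ℂ) {N M : ℕ} (p : Fin (N + M) → ℂ)
    (A : Matrix (Fin M) (Fin N) ℂ) (t : Times) (hp : ∀ i j, qPart p i ≠ pPart p j) :
    tauVO a b e p A t = ∑ I ∈ indexSets N M, minorB p A I * dressedTerm a b e p t I := by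
  unfold minorB
  rw [sum_minor_mul_alternating _ _ (dressedTerm_perm a b e p t) (dressedTerm_eq_zero a b e p t),
    sum_prod_Bmat, tauVO, expVertex, ← tsum_mul_left]
  set X := vdm (fun j => (pPart p j)⁻¹) * Complex.exp (∑ j, eta t (pPart p j)⁻¹)
  rw [← tsum_words (fun n w => X * ((∏ k, A (w k).1 (w k).2) *
    vertexProd (fun k => (qPart p (w k).1)⁻¹) (fun k => (pPart p (w k).2)⁻¹)
      (fun s => tau0 a b e (s - ∑ j, miwa (pPart p j))) t))]
  · refine tsum_congr fun n => ?_
    rw [← mul_sum]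
    ring
  · intro n w hw
    simp only [Function.Injective, not_forall] at hw
    obtain ⟨k, l, hkl, hne⟩ := hw
    -- Two equal second letters give a factor `Q_k - Q_l = 0` in the numerator.
    have hz : vertexCoeff (fun k => (qPart p (w k).1)⁻¹) (fun k => (pPart p (w k).2)⁻¹) = 0 := by
      wlog hlt : k < l generalizing k l
      · exact this l k hkl.symm (Ne.symm hne) (lt_of_le_of_ne (not_lt.1 hlt) (Ne.symm hne))
      refine prod_eq_zero (mem_univ k) (prod_eq_zero (mem_Ioi.2 hlt) ?_)
      simp only [hkl, sub_self, mul_zero, zero_div]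
    rw [vertexProd, hz]
    ring
  · intro n w g h
    have h1 := vdm_mul_vertexCoeff (fun r => (p r)⁻¹)
      (fun i j hij => hp i j (inv_injective hij)) n w g h
    have h2 := h.prod_selectRow (fun s r => Bmat p A r s) fun s => by
      rw [Bmat_castAdd, if_pos rfl]
    have h3 := h.sum_selectRow fun r => eta t (p r)⁻¹
    have h4 := h.sum_selectRow fun r => miwa (p r)
    simp only [Bmat_natAdd, prod_mul_distrib] at h2
    simp only [vertexProd, normalOrdered, dressedTerm, inv_inv, X]
    rw [h2, h3, Complex.exp_add]
    have h5 : t - ∑ k, miwa (qPart p (w k).1) + ∑ k, miwa (pPart p (w k).2) -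
        ∑ j, miwa (pPart p j) = t - ∑ s, miwa (p (selectRow g s)) := by
      rw [h4]
      simp only [pPart, qPart]
      abel
    rw [h5, sum_sub_distrib]
    simp only [pPart, qPart] at h1 ⊢
    linear_combination Complex.exp (∑ j, eta t (p (Fin.castAdd M j))⁻¹) *
      (∏ k, A (w k).1 (w k).2) * Complex.exp (∑ k, eta t (p (Fin.natAdd N (w k).1))⁻¹ -
        ∑ k, eta t (p (Fin.castAdd M (w k).2))⁻¹) *
      tau0 a b e (t - ∑ s, miwa (p (selectRow g s))) * h1

/-! ### The odd theta function -/

/-- Quasi-periodicity gives opposite values at `1/2 + τ/2` and `1/2 - τ/2`, while evenness and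
period `1` give equal ones. -/
theorem jacobiTheta₂_half (τ : ℂ) : jacobiTheta₂ (1 / 2 + τ / 2) τ = 0 := by
  have h := jacobiTheta₂_add_left' (1 / 2 - τ / 2) τ
  have e1 : (1 / 2 - τ / 2 + τ : ℂ) = 1 / 2 + τ / 2 := by ring
  have e2 : Complex.exp (-Real.pi * Complex.I * (τ + 2 * (1 / 2 - τ / 2))) = -1 := by
    rw [show -Real.pi * Complex.I * (τ + 2 * (1 / 2 - τ / 2)) = -(Real.pi * Complex.I) by ring,
      Complex.exp_neg, Complex.exp_pi_mul_I]
    norm_num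
  have e3 : jacobiTheta₂ (1 / 2 - τ / 2) τ = jacobiTheta₂ (1 / 2 + τ / 2) τ := by
    rw [← jacobiTheta₂_neg_left, ← jacobiTheta₂_add_left]
    congr 1
    ring
  rw [e1, e2, e3] at h
  have h2 : (2 : ℂ) * jacobiTheta₂ (1 / 2 + τ / 2) τ = 0 := by linear_combination h
  simpa using h2

/-- Pairing `n` with `-n-1` turns the derivative into `2πi ∑ (2n+1)(-1)ⁿ e^{-πa n(n+1)}`. The
leading term is `1`, and for `a ≥ 1` the tail is dominated by a geometric series of sum less than
`1`. -/
theorem jacobiTheta₂'_half_ne_zero_of_one_le {a : ℝ} (ha : 1 ≤ a) :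
    jacobiTheta₂' (1 / 2 + Complex.I * a / 2) (Complex.I * a) ≠ 0 := by
  set τ : ℂ := Complex.I * a with hτ
  have him : 0 < τ.im := by
    simp [hτ]
    linarith
  have hterm : ∀ n : ℤ, jacobiTheta₂'_term n (1 / 2 + τ / 2) τ =
      2 * Real.pi * Complex.I * ((n : ℂ) * (-1) ^ n * Real.exp (-(Real.pi * a * (n * (n + 1))))) := by
    intro n
    have e1 : 2 * Real.pi * Complex.I * n * (1 / 2 + τ / 2) + Real.pi * Complex.I * n ^ 2 * τ =
        n * (Real.pi * Complex.I) + ((-(Real.pi * a * (n * (n + 1))) : ℝ) : ℂ) := by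
      rw [hτ]
      push_cast
      linear_combination (Real.pi * a * n + Real.pi * n ^ 2 * a : ℂ) * Complex.I_mul_I
    rw [jacobiTheta₂'_term, jacobiTheta₂_term, e1, Complex.exp_add, Complex.exp_int_mul,
      Complex.exp_pi_mul_I, Complex.ofReal_exp]
    ring
  have hs := (hasSum_jacobiTheta₂'_term (1 / 2 + τ / 2) him)
  have hs2 := hs.nat_add_neg_add_one
  set g : ℕ → ℂ := fun n => (2 * n + 1) * (-1) ^ n *
    Real.exp (-(Real.pi * a * (n * (n + 1)))) with hg
  have hs3 : HasSum (fun n => 2 * Real.pi * Complex.I * g n)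
      (jacobiTheta₂' (1 / 2 + τ / 2) τ) := by
    refine hs2.congr_fun ?_ |> fun h => h
    intro n
    rw [hterm, hterm, hg]
    have e1 : ((-1 : ℂ)) ^ (-((n : ℤ) + 1)) = -(-1) ^ n := by
      rw [zpow_neg, ← Nat.cast_succ, zpow_natCast, pow_succ, mul_neg_one, inv_neg]
      rcases neg_one_pow_eq_or ℂ n with h | h <;> rw [h] <;> norm_num
    have e2 : -(Real.pi * a * (((-((n : ℤ) + 1) : ℤ) : ℝ) * (((-((n : ℤ) + 1) : ℤ) : ℝ) + 1))) =
        -(Real.pi * a * (n * (n + 1))) := by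
      push_cast
      ring
    rw [e1, e2, zpow_natCast]
    push_cast
    ring
  have hc : (2 * Real.pi * Complex.I : ℂ) ≠ 0 := by
    simp [Real.pi_ne_zero]
  -- From `e^{2πa} ≥ 1 + 2πa > 7`; then `q < 3/7 < 1/2`, which makes `q/(1-q) < 1`.
  have hq : Real.exp (-(2 * Real.pi * a)) < 1 / 7 := by
    have h1 : (2 * Real.pi * a) ≥ 6 := by
      nlinarith [Real.pi_gt_three]
    have h2 := Real.add_one_le_exp (2 * Real.pi * a)
    have h3 : (2 * Real.pi * a) > 6 := by
      nlinarith [Real.pi_gt_three]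
    rw [Real.exp_neg, inv_lt_comm₀ (Real.exp_pos _) (by norm_num)]
    norm_num
    linarith
  set q := 3 * Real.exp (-(2 * Real.pi * a)) with hqd
  have hq0 : 0 < q := by positivity
  have hq1 : q < 1 / 2 := by linarith
  have hbound : ∀ n : ℕ, ‖g (n + 1)‖ ≤ q ^ (n + 1) := by
    intro n
    rw [hg]
    simp only [norm_mul, norm_pow, norm_neg, norm_one, one_pow, mul_one]
    rw [hqd, mul_pow, ← Real.exp_nat_mul, Complex.norm_real, Real.norm_of_nonneg (Real.exp_pos _).le]
    have h1 : ‖(2 * ((n + 1 : ℕ) : ℂ) + 1)‖ = 2 * (n + 1) + 1 := by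
      rw [show (2 * ((n + 1 : ℕ) : ℂ) + 1) = ((2 * (n + 1) + 1 : ℕ) : ℂ) by push_cast; ring,
        Complex.norm_natCast]
      push_cast
      ring
    have h2 : (2 * (n + 1) + 1 : ℝ) ≤ 3 ^ (n + 1) := by
      have := one_add_mul_le_pow (show (-2 : ℝ) ≤ 2 by norm_num) (n + 1)
      push_cast at this
      norm_num at this
      linarith
    rw [h1]
    refine mul_le_mul h2 (Real.exp_le_exp.2 ?_) (Real.exp_pos _).le (by positivity)
    push_cast
    have : 0 ≤ Real.pi * a * ((n + 1) * n) := by positivity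
    nlinarith
  intro h0
  rw [h0] at hs3
  have hs4 : HasSum g 0 := by
    have := hs3.mul_left (2 * Real.pi * Complex.I)⁻¹
    simpa [← mul_assoc, inv_mul_cancel₀ hc] using! this
  have hs5 := (hasSum_nat_add_iff' 1).2 hs4
  have hgeo : HasSum (fun n : ℕ => q ^ (n + 1)) (q * (1 - q)⁻¹) := by
    simpa [pow_succ'] using! (hasSum_geometric_of_lt_one hq0.le (by linarith)).mul_left q
  have hle := hs5.norm_le_of_bounded hgeo hbound
  have hg0 : g 0 = 1 := by simp [hg]
  rw [sum_range_one, hg0] at hle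
  norm_num at hle
  rw [← div_eq_mul_inv, le_div_iff₀ (by linarith)] at hle
  linarith

/-- The inversion `τ ↦ -1/τ` exchanges `a` and `1/a`. In the functional equation of the derivative
the term with `jacobiTheta₂` itself drops out, since that function vanishes at the half period. -/
theorem jacobiTheta₂'_half_ne_zero {a : ℝ} (ha : 0 < a) :
    jacobiTheta₂' (1 / 2 + Complex.I * a / 2) (Complex.I * a) ≠ 0 := by
  rcases le_total 1 a with h | h
  · exact jacobiTheta₂'_half_ne_zero_of_one_le h
  have ha' : (a : ℂ) ≠ 0 := by exact_mod_cast ha.ne'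
  have h1 : 1 ≤ a⁻¹ := (one_le_inv₀ ha).2 h
  have key := jacobiTheta₂'_half_ne_zero_of_one_le h1
  set τ' : ℂ := Complex.I * (a⁻¹ : ℝ) with hτ'
  have e1 : -1 / (Complex.I * a) = τ' := by
    rw [hτ', div_eq_iff (mul_ne_zero Complex.I_ne_zero ha')]
    push_cast
    field_simp
    linear_combination -Complex.I_sq
  have e2 : (1 / 2 + Complex.I * a / 2) / (Complex.I * a) = 1 / 2 - τ' / 2 := by
    rw [← e1]
    have := Complex.I_ne_zero
    field_simp
    ring
  have e3 : jacobiTheta₂ (1 / 2 - τ' / 2) τ' = 0 := by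
    rw [← jacobiTheta₂_neg_left, ← jacobiTheta₂_add_left, ← jacobiTheta₂_half τ']
    congr 1
    ring
  have e4 : jacobiTheta₂' (1 / 2 - τ' / 2) τ' = -jacobiTheta₂' (1 / 2 + τ' / 2) τ' := by
    rw [← neg_neg (jacobiTheta₂' (1 / 2 - τ' / 2) τ'), ← jacobiTheta₂'_neg_left,
      ← jacobiTheta₂'_add_left]
    congr 2
    ring
  rw [jacobiTheta₂'_functional_equation, e1, e2, e3, e4, mul_zero, sub_zero]
  have hI : -Complex.I * (Complex.I * a) = a := by
    linear_combination (-(a : ℂ)) * Complex.I_mul_I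
  rw [hI]
  refine mul_ne_zero (div_ne_zero (mul_ne_zero (one_div_ne_zero ?_) (Complex.exp_ne_zero _))
    (mul_ne_zero Complex.I_ne_zero ha')) (neg_ne_zero.2 key)
  rw [Complex.cpow_def_of_ne_zero ha']
  exact Complex.exp_ne_zero _

section

variable {a b : ℝ}

theorem modulus_im_pos (ha : 0 < a) (hb : 0 < b) : 0 < (modulus a b).im := by
  simp [modulus_eq a hb, ha]

theorem differentiable_theta (ha : 0 < a) (hb : 0 < b) : Differentiable ℂ (theta a b) :=
  fun z => differentiableAt_jacobiTheta₂_fst z (modulus_im_pos ha hb)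

theorem theta11_eq (a b : ℝ) (z : ℂ) : theta11 a b z =
    Complex.exp (Real.pi * Complex.I * modulus a b / 4 + Real.pi * Complex.I * (z + 1 / 2)) *
      jacobiTheta₂ (z + (1 / 2 + modulus a b / 2)) (modulus a b) := by
  rw [theta11, jacobiTheta₂, ← tsum_mul_left]
  refine tsum_congr fun n => ?_
  rw [jacobiTheta₂_term, ← Complex.exp_add]
  congr 1
  ring

/-- The reflection `n ↦ -1-n` negates `n + 1/2`; the shift `z + 1/2` then leaves an odd multiple of
`πi` in the exponent. -/
theorem theta11_neg (a b : ℝ) (z : ℂ) : theta11 a b (-z) = -theta11 a b z := by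
  rw [theta11, theta11, ← tsum_neg, ← (Equiv.subLeft (-1 : ℤ)).tsum_eq]
  refine tsum_congr fun n => ?_
  have h : Complex.exp ((n : ℂ) * (2 * Real.pi * Complex.I) + Real.pi * Complex.I) = -1 := by
    rw [Complex.exp_add, Complex.exp_int_mul_two_pi_mul_I, Complex.exp_pi_mul_I, one_mul]
  rw [← mul_neg_one (Complex.exp _), ← h, ← Complex.exp_add, Complex.exp_eq_exp_iff_exists_int]
  refine ⟨-(2 * n + 1), ?_⟩
  simp only [Equiv.subLeft_apply]
  push_cast
  ring

theorem theta11_zero (a b : ℝ) : theta11 a b 0 = 0 := by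
  have h := theta11_neg a b 0
  rw [neg_zero] at h
  exact self_eq_neg.1 h

theorem hasDerivAt_theta11_zero (ha : 0 < a) (hb : 0 < b) : HasDerivAt (theta11 a b)
    (Complex.exp (Real.pi * Complex.I * modulus a b / 4 + Real.pi * Complex.I * (0 + 1 / 2)) *
      jacobiTheta₂' (1 / 2 + modulus a b / 2) (modulus a b)) 0 := by
  have h1 : HasDerivAt (fun z : ℂ => jacobiTheta₂ (z + (1 / 2 + modulus a b / 2)) (modulus a b))
      (jacobiTheta₂' (1 / 2 + modulus a b / 2) (modulus a b)) 0 := by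
    refine HasDerivAt.comp_add_const (x := (0 : ℂ)) (a := 1 / 2 + modulus a b / 2)
      (f := fun z => jacobiTheta₂ z (modulus a b)) ?_
    rw [zero_add]
    exact hasDerivAt_jacobiTheta₂_fst _ (modulus_im_pos ha hb)
  have h2 : DifferentiableAt ℂ (fun z : ℂ => Complex.exp (Real.pi * Complex.I * modulus a b / 4 +
      Real.pi * Complex.I * (z + 1 / 2))) 0 := by fun_prop
  have h3 := h2.hasDerivAt.mul h1
  rw [zero_add, jacobiTheta₂_half, mul_zero, zero_add] at h3
  exact h3.congr_of_eventuallyEq (Eventually.of_forall fun z => theta11_eq a b z)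

theorem differentiable_theta11 (ha : 0 < a) (hb : 0 < b) : Differentiable ℂ (theta11 a b) := by
  rw [funext (theta11_eq a b)]
  refine Differentiable.mul (by fun_prop) fun z => ?_
  exact DifferentiableAt.comp (g := fun z => jacobiTheta₂ z (modulus a b)) z
    (differentiableAt_jacobiTheta₂_fst _ (modulus_im_pos ha hb)) (by fun_prop)

theorem twoω₁_ne_zero (hb : 0 < b) : twoω₁ b ≠ 0 := by
  have : (b : ℂ) ≠ 0 := by exact_mod_cast hb.ne'
  exact neg_ne_zero.2 (mul_ne_zero Complex.I_ne_zero this)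

theorem mul_thetaQuot (a b : ℝ) (u : ℂ) : u * thetaQuot a b u = theta11 a b (u / twoω₁ b) := by
  have h := sub_smul_dslope (fun u => theta11 a b (u / twoω₁ b)) 0 u
  simpa [theta11_zero] using! h

theorem differentiable_thetaQuot (ha : 0 < a) (hb : 0 < b) : Differentiable ℂ (thetaQuot a b) := by
  have h : Differentiable ℂ fun u => theta11 a b (u / twoω₁ b) :=
    (differentiable_theta11 ha hb).comp (by fun_prop)
  have := (Complex.differentiableOn_dslope (f := fun u => theta11 a b (u / twoω₁ b))
    (univ_mem : Set.univ ∈ 𝓝 (0 : ℂ))).2 h.differentiableOn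
  exact differentiableOn_univ.1 this

/-- The value at `0` is `θ₁₁'(0)/2ω₁`. Its nonvanishing gives a logarithm of `thetaQuot` near `0`,
keeps `0` out of the singular set of the continuation, and makes the constant `c` nonzero. -/
theorem thetaQuot_zero_ne_zero (ha : 0 < a) (hb : 0 < b) : thetaQuot a b 0 ≠ 0 := by
  have h := hasDerivAt_theta11_zero ha hb
  have h0 : (0 : ℂ) / twoω₁ b = 0 := zero_div _
  rw [← h0] at h
  have h2 := h.comp (0 : ℂ) ((hasDerivAt_id (0 : ℂ)).div_const (twoω₁ b))
  rw [thetaQuot, dslope_same, show (fun u => theta11 a b (u / twoω₁ b)) =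
    theta11 a b ∘ fun u => id u / twoω₁ b from rfl, h2.deriv]
  refine mul_ne_zero (mul_ne_zero (Complex.exp_ne_zero _) ?_)
    (one_div_ne_zero (twoω₁_ne_zero hb))
  rw [modulus_eq a hb]
  exact jacobiTheta₂'_half_ne_zero ha

theorem thetaQuot_neg (a b : ℝ) (u : ℂ) : thetaQuot a b (-u) = thetaQuot a b u := by
  by_cases hu : u = 0
  · rw [hu, neg_zero]
  · have h1 := mul_thetaQuot a b u
    have h2 := mul_thetaQuot a b (-u)
    rw [neg_div, theta11_neg, ← h1] at h2
    exact mul_left_cancel₀ (neg_ne_zero.2 hu) (by linear_combination h2)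

theorem thetaQuot_ne_zero {u : ℂ} (h : theta11 a b (u / twoω₁ b) ≠ 0) : thetaQuot a b u ≠ 0 := by
  rw [← mul_thetaQuot] at h
  exact right_ne_zero_of_mul h

theorem ne_zero_of_theta11_ne_zero {u : ℂ} (h : theta11 a b (u / twoω₁ b) ≠ 0) : u ≠ 0 := by
  rw [← mul_thetaQuot] at h
  exact left_ne_zero_of_mul h

end

/-! ### Regularised coefficients of the logarithmic derivative -/

/-- The logarithmic derivative of `θ₁₁(u / 2ω₁) / u`. -/
noncomputable def logDerivQuot (a b : ℝ) : ℂ → ℂ := logDeriv (thetaQuot a b)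

/-- The analogue of `Fcoef` for `θ₁₁(u / 2ω₁) / u`. -/
noncomputable def regCoef (a b : ℝ) (k : ℕ+) (w : ℂ) : ℂ :=
  (-1) ^ ((k : ℕ) - 1) / (((k : ℕ) - 1).factorial : ℂ) *
    iteratedDeriv ((k : ℕ) - 1) (logDerivQuot a b) w

theorem iteratedDeriv_add_index (m n : ℕ) (f : ℂ → ℂ) :
    iteratedDeriv m (iteratedDeriv n f) = iteratedDeriv (m + n) f := by
  rw [iteratedDeriv_eq_iterate, iteratedDeriv_eq_iterate, iteratedDeriv_eq_iterate,
    Function.iterate_add_apply]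

/-- The bidifferential depends on `z₂ - z₁` only, so all `q_{ij}` are derivatives at `0` of one
function of a single variable. -/
theorem bidiff_eq (a b : ℝ) (z₁ z₂ : ℂ) :
    bidiff a b z₁ z₂ = -deriv (logDerivQuot a b) (z₂ - z₁) := by
  have h : (fun w₁ => logDeriv (fun w₂ => thetaQuot a b (w₂ - w₁)) z₂) =
      fun w₁ => logDerivQuot a b (z₂ - w₁) := by
    funext w₁
    rw [logDeriv_apply, deriv_comp_sub_const, logDerivQuot, logDeriv_apply]
  rw [bidiff, h, deriv_comp_const_sub]

theorem qcoef_eq (a b : ℝ) (i j : ℕ+) :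
    qcoef a b i j = -(-1) ^ ((i : ℕ) - 1) *
      iteratedDeriv ((i : ℕ) - 1 + j) (logDerivQuot a b) 0 /
      ((((i : ℕ) - 1).factorial : ℂ) * (((j : ℕ) - 1).factorial : ℂ)) := by
  have h1 : ∀ z₁, iteratedDeriv ((j : ℕ) - 1) (fun z₂ => bidiff a b z₁ z₂) 0 =
      -iteratedDeriv j (logDerivQuot a b) (0 - z₁) := by
    intro z₁
    have : (fun z₂ => bidiff a b z₁ z₂) = fun z₂ => -deriv (logDerivQuot a b) (z₂ - z₁) :=
      funext fun z₂ => bidiff_eq a b z₁ z₂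
    rw [this, iteratedDeriv_fun_neg, iteratedDeriv_comp_sub_const, ← iteratedDeriv_succ',
      Nat.sub_add_cancel j.pos]
  rw [qcoef, funext h1, iteratedDeriv_fun_neg, iteratedDeriv_comp_const_sub, iteratedDeriv_add_index]
  simp only [sub_zero, smul_eq_mul]
  ring

theorem logDerivQuot_neg (a b : ℝ) (u : ℂ) : logDerivQuot a b (-u) = -logDerivQuot a b u := by
  have h : deriv (fun x => thetaQuot a b (-x)) u = -deriv (thetaQuot a b) (-u) :=
    deriv_comp_neg _ _
  rw [funext (thetaQuot_neg a b)] at h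
  rw [logDerivQuot, logDeriv_apply, logDeriv_apply, thetaQuot_neg, h]
  ring

/-- `logDerivQuot` is odd, so its derivative of order `i+j-1` at `0` vanishes unless `i+j` is even,
and then the two signs agree. -/
theorem qcoef_symm (a b : ℝ) (i j : ℕ+) : qcoef a b i j = qcoef a b j i := by
  obtain ⟨m, hm⟩ : ∃ m, (i : ℕ) = m + 1 := ⟨i - 1, (Nat.sub_add_cancel i.pos).symm⟩
  obtain ⟨n, hn⟩ : ∃ n, (j : ℕ) = n + 1 := ⟨j - 1, (Nat.sub_add_cancel j.pos).symm⟩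
  rw [qcoef_eq, qcoef_eq, hm, hn, Nat.add_sub_cancel, Nat.add_sub_cancel,
    show n + (m + 1) = m + (n + 1) by ring]
  have h := iteratedDeriv_comp_neg (m + (n + 1)) (logDerivQuot a b) 0
  rw [funext (logDerivQuot_neg a b), iteratedDeriv_fun_neg, neg_zero, smul_eq_mul] at h
  set X := iteratedDeriv (m + (n + 1)) (logDerivQuot a b) 0
  have h' : (-1 : ℂ) ^ m * X = (-1) ^ n * X := by
    have hs : ((-1 : ℂ) ^ n) * (-1) ^ n = 1 := by
      rw [← pow_add, ← two_mul, pow_mul]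
      simp
    have h2 : X = (-1) ^ (m + n) * X := by
      have : (-1 : ℂ) ^ (m + (n + 1)) = -(-1) ^ (m + n) := by ring
      rw [this] at h
      linear_combination -h
    calc (-1 : ℂ) ^ m * X = ((-1) ^ n * (-1) ^ n) * ((-1) ^ m * X) := by rw [hs, one_mul]
      _ = (-1) ^ n * ((-1) ^ (m + n) * X) := by rw [pow_add]; ring
      _ = _ := by rw [← h2]
  rw [mul_comm (m.factorial : ℂ)]
  congr 1
  linear_combination -h'

section

variable {a b : ℝ} (ha : 0 < a) (hb : 0 < b)

include ha hb

theorem differentiableAt_logDerivQuot {u : ℂ} (hu : thetaQuot a b u ≠ 0) :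
    DifferentiableAt ℂ (logDerivQuot a b) u := by
  have h := differentiable_thetaQuot ha hb
  exact (h.deriv u).div (h u) hu

theorem isOpen_thetaQuot_ne_zero : IsOpen {u : ℂ | thetaQuot a b u ≠ 0} :=
  isOpen_ne_fun (differentiable_thetaQuot ha hb).continuous continuous_const

theorem differentiableOn_logDerivQuot :
    DifferentiableOn ℂ (logDerivQuot a b) {u | thetaQuot a b u ≠ 0} := fun _ hu =>
  (differentiableAt_logDerivQuot ha hb hu).differentiableWithinAt

theorem differentiableOn_iteratedDeriv_logDerivQuot (n : ℕ) :
    DifferentiableOn ℂ (iteratedDeriv n (logDerivQuot a b)) {u | thetaQuot a b u ≠ 0} := by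
  induction n with
  | zero =>
    rw [iteratedDeriv_zero]
    exact differentiableOn_logDerivQuot ha hb
  | succ n ih =>
    rw [iteratedDeriv_succ]
    exact ih.deriv (isOpen_thetaQuot_ne_zero ha hb)

/-- Cauchy estimates for the logarithmic derivative, locally uniformly. -/
theorem exists_norm_iteratedDeriv_logDerivQuot_le {w₀ : ℂ} (hw : thetaQuot a b w₀ ≠ 0) :
    ∃ δ > 0, ∃ C ≥ 0, ∀ w ∈ Metric.ball w₀ δ, thetaQuot a b w ≠ 0 ∧
      ∀ n : ℕ, ‖iteratedDeriv n (logDerivQuot a b) w‖ ≤ n.factorial * C / δ ^ n := by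
  obtain ⟨ε, hε, hball⟩ := Metric.isOpen_iff.1 (isOpen_thetaQuot_ne_zero ha hb) w₀ hw
  have hsub : Metric.closedBall w₀ (2 * (ε / 4)) ⊆ {u | thetaQuot a b u ≠ 0} :=
    (Metric.closedBall_subset_ball (by linarith)).trans hball
  obtain ⟨C, hC⟩ := (isCompact_closedBall w₀ (2 * (ε / 4))).exists_bound_of_continuousOn
    ((differentiableOn_logDerivQuot ha hb).continuousOn.mono hsub)
  have hε' : 0 < ε / 4 := by linarith
  have hw' : ∀ w ∈ Metric.ball w₀ (ε / 4), Metric.closedBall w (ε / 4) ⊆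
      Metric.closedBall w₀ (2 * (ε / 4)) := fun w hw => by
    refine Metric.closedBall_subset_closedBall' ?_
    have := Metric.mem_ball.1 hw
    linarith
  refine ⟨ε / 4, hε', max C 0, le_max_right _ _, fun w hw => ⟨?_, fun n => ?_⟩⟩
  · exact hsub (hw' w hw (Metric.mem_closedBall_self hε'.le))
  · refine Complex.norm_iteratedDeriv_le_of_forall_mem_sphere_norm_le n hε' ?_ fun z hz => ?_
    · refine DifferentiableOn.diffContOnCl ?_
      rw [closure_ball _ hε'.ne']
      exact (differentiableOn_logDerivQuot ha hb).mono ((hw' w hw).trans hsub)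
    · exact (hC z (hw' w hw (Metric.sphere_subset_closedBall hz))).trans (le_max_left _ _)

theorem exists_norm_regCoef_le {w₀ : ℂ} (hw : thetaQuot a b w₀ ≠ 0) :
    ∃ δ > 0, ∃ C ≥ 0, ∃ ρ > 0, ∀ w ∈ Metric.ball w₀ δ, thetaQuot a b w ≠ 0 ∧
      ∀ k : ℕ+, ‖regCoef a b k w‖ ≤ C * ρ ^ (k : ℕ) := by
  obtain ⟨δ, hδ, C, hC, h⟩ := exists_norm_iteratedDeriv_logDerivQuot_le ha hb hw
  refine ⟨δ, hδ, C * δ, by positivity, δ⁻¹, by positivity, fun w hw => ⟨(h w hw).1, fun k => ?_⟩⟩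
  obtain ⟨n, hn⟩ : ∃ n, (k : ℕ) = n + 1 := ⟨k - 1, (Nat.sub_add_cancel k.pos).symm⟩
  have h1 := (h w hw).2 n
  rw [regCoef, hn, Nat.add_sub_cancel, norm_mul, norm_div, norm_pow, norm_neg, norm_one, one_pow,
    Complex.norm_natCast]
  have hf : (0 : ℝ) < n.factorial := by exact_mod_cast n.factorial_pos
  calc 1 / (n.factorial : ℝ) * ‖iteratedDeriv n (logDerivQuot a b) w‖
      ≤ 1 / (n.factorial : ℝ) * (n.factorial * C / δ ^ n) := by gcongr
    _ = C * δ * δ⁻¹ ^ (n + 1) := by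
      rw [inv_pow, pow_succ]
      field_simp

end

/-- `K` controls the Taylor expansions at `0`. -/
structure IsBound (a b K : ℝ) : Prop where
  pos : 0 < K
  ne_zero : ∀ u : ℂ, ‖u‖ < 2 / K → thetaQuot a b u ≠ 0
  bound : ∃ C ≥ 0, ∀ i j : ℕ+, ‖qcoef a b i j‖ ≤ C * (K ^ (i : ℕ) * K ^ (j : ℕ))

/-- Separates the Cauchy bound for a derivative of order `m+n+1` into geometric factors in each
index, at the price of a factor `4` per order. -/
theorem factorial_add_add_one_le (m n : ℕ) :
    (m + (n + 1)).factorial ≤ 4 ^ (m + (n + 1)) * (m.factorial * n.factorial) := by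
  rw [← add_assoc, Nat.factorial_succ, ← Nat.add_choose_mul_factorial_mul_factorial]
  have h1 := Nat.choose_le_two_pow (m + n) n
  have h2 : m + n + 1 ≤ 2 ^ (m + n + 1) := Nat.lt_two_pow_self.le
  calc (m + n + 1) * ((m + n).choose n * m.factorial * n.factorial)
      ≤ 2 ^ (m + n + 1) * (2 ^ (m + n) * m.factorial * n.factorial) := by gcongr
    _ ≤ 2 ^ (m + n + 1) * (2 ^ (m + n + 1) * m.factorial * n.factorial) := by
        have := Nat.pow_le_pow_right (n := 2) two_pos (Nat.le_succ (m + n))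
        exact Nat.mul_le_mul_left _ (Nat.mul_le_mul_right _ (Nat.mul_le_mul_right _ this))
    _ = 4 ^ (m + n + 1) * (m.factorial * n.factorial) := by
        rw [show (4 : ℕ) = 2 * 2 by rfl, mul_pow]
        ring

theorem exists_isBound {a b : ℝ} (ha : 0 < a) (hb : 0 < b) : ∃ K, IsBound a b K := by
  obtain ⟨δ, hδ, C, hC, h⟩ := exists_norm_iteratedDeriv_logDerivQuot_le ha hb
    (thetaQuot_zero_ne_zero ha hb)
  -- The `4` absorbs the factorial estimate; moreover `2/K = δ/2` stays inside the disc where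
  -- `thetaQuot` has no zero.
  refine ⟨4 / δ, by positivity, fun u hu => ?_, C * (δ / 4), by positivity, fun i j => ?_⟩
  · refine (h u ?_).1
    rw [mem_ball_zero_iff]
    refine hu.trans ?_
    rw [div_div_eq_mul_div]
    linarith
  · obtain ⟨m, hm⟩ : ∃ m, (i : ℕ) = m + 1 := ⟨i - 1, (Nat.sub_add_cancel i.pos).symm⟩
    obtain ⟨n, hn⟩ : ∃ n, (j : ℕ) = n + 1 := ⟨j - 1, (Nat.sub_add_cancel j.pos).symm⟩
    rw [qcoef_eq, hm, hn, Nat.add_sub_cancel, Nat.add_sub_cancel]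
    have h1 := (h 0 (Metric.mem_ball_self hδ)).2 (m + (n + 1))
    have h2 : ((m + (n + 1)).factorial : ℝ) ≤
        4 ^ (m + (n + 1)) * (m.factorial * n.factorial) := by
      exact_mod_cast factorial_add_add_one_le m n
    have h3 : (0 : ℝ) < m.factorial * n.factorial := by
      exact_mod_cast Nat.mul_pos m.factorial_pos n.factorial_pos
    simp only [norm_div, norm_mul, norm_neg, norm_pow, norm_one, one_pow, one_mul,
      Complex.norm_natCast]
    rw [div_le_iff₀ h3]
    calc _ ≤ _ := h1
      _ ≤ (4 ^ (m + (n + 1)) * (m.factorial * n.factorial)) * C / δ ^ (m + (n + 1)) := by gcongr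
      _ = _ := by
        simp only [div_pow, pow_add, pow_one]
        field_simp

/-! ### The bilinear form -/

/-- Times with `∑ |tₖ| Kᵏ < ∞`. -/
def IsTame (K : ℝ) (t : Times) : Prop := Summable fun k : ℕ+ => ‖t k‖ * K ^ (k : ℕ)

theorem IsEntireTimes.isTame {t : Times} (ht : IsEntireTimes t) (K : ℝ) : IsTame K t := ht K

theorem IsTame.add {K : ℝ} (hK : 0 ≤ K) {s t : Times} (hs : IsTame K s) (ht : IsTame K t) :
    IsTame K (s + t) := by
  refine Summable.of_nonneg_of_le (fun k => by positivity) (fun k => ?_) (Summable.add hs ht)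
  rw [← add_mul]
  exact mul_le_mul_of_nonneg_right (norm_add_le _ _) (by positivity)

theorem IsTame.neg {K : ℝ} {t : Times} (ht : IsTame K t) : IsTame K (-t) := by
  simpa only [IsTame, Pi.neg_apply, norm_neg] using ht

theorem isTame_zero (K : ℝ) : IsTame K 0 := by
  simp [IsTame, summable_zero]

theorem isTame_sum {K : ℝ} (hK : 0 ≤ K) {ι : Type*} (S : Finset ι) {f : ι → Times}
    (hf : ∀ i, IsTame K (f i)) : IsTame K (∑ i ∈ S, f i) := by
  classical
  induction S using Finset.induction_on with
  | empty => simpa using isTame_zero K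
  | insert i S hi ih => rw [sum_insert hi]; exact (hf i).add hK ih

/-- Only shifts `[w]` with `w` small are admissible for the series of `q`; this is why the seed must
be continued analytically. -/
theorem isTame_miwa {K : ℝ} (hK : 0 < K) {w : ℂ} (hw : ‖w‖ < 1 / K) : IsTame K (miwa w) := by
  have h1 : ‖w‖ * K < 1 := by rwa [lt_div_iff₀ hK] at hw
  have hs : Summable fun k : ℕ+ => (‖w‖ * K) ^ (k : ℕ) :=
    (summable_geometric_of_lt_one (by positivity) h1).comp_injective PNat.coe_injective
  refine Summable.of_nonneg_of_le (fun k => by positivity) (fun k => ?_) hs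
  rw [miwa, norm_div, norm_pow, Complex.norm_natCast, mul_pow]
  refine mul_le_mul_of_nonneg_right (div_le_self (by positivity) ?_) (by positivity)
  exact_mod_cast k.pos

/-- The symmetric bilinear form with matrix `q_{ij}`. -/
noncomputable def qbilin (a b : ℝ) (s t : Times) : ℂ :=
  ∑' ij : ℕ+ × ℕ+, qcoef a b ij.1 ij.2 * s ij.1 * t ij.2

theorem qform_eq_qbilin (a b : ℝ) (t : Times) : qform a b t = qbilin a b t t := rfl

theorem IsBound.summable {a b K : ℝ} (h : IsBound a b K) {s t : Times} (hs : IsTame K s)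
    (ht : IsTame K t) :
    Summable fun ij : ℕ+ × ℕ+ => qcoef a b ij.1 ij.2 * s ij.1 * t ij.2 := by
  obtain ⟨C, hC, hq⟩ := h.bound
  have hK := h.pos
  have h1 := (Summable.mul_of_nonneg hs ht (fun k => by positivity)
    (fun k => by positivity)).mul_left C
  refine Summable.of_norm_bounded h1 fun ij => ?_
  rw [norm_mul, norm_mul]
  calc ‖qcoef a b ij.1 ij.2‖ * ‖s ij.1‖ * ‖t ij.2‖
      ≤ C * (K ^ (ij.1 : ℕ) * K ^ (ij.2 : ℕ)) * ‖s ij.1‖ * ‖t ij.2‖ := by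
        gcongr
        exact hq _ _
    _ = _ := by ring

theorem qbilin_symm (a b : ℝ) (s t : Times) : qbilin a b s t = qbilin a b t s := by
  rw [qbilin, qbilin, ← (Equiv.prodComm ℕ+ ℕ+).tsum_eq]
  refine tsum_congr fun ij => ?_
  simp only [Equiv.prodComm_apply, Prod.fst_swap, Prod.snd_swap]
  rw [qcoef_symm]
  ring

theorem IsBound.qbilin_add_left {a b K : ℝ} (h : IsBound a b K) {s s' t : Times}
    (hs : IsTame K s) (hs' : IsTame K s') (ht : IsTame K t) :
    qbilin a b (s + s') t = qbilin a b s t + qbilin a b s' t := by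
  rw [qbilin, qbilin, qbilin, ← (h.summable hs ht).tsum_add (h.summable hs' ht)]
  refine tsum_congr fun ij => ?_
  simp only [Pi.add_apply]
  ring

theorem qbilin_neg_left (a b : ℝ) (s t : Times) : qbilin a b (-s) t = -qbilin a b s t := by
  rw [qbilin, qbilin, ← tsum_neg]
  refine tsum_congr fun ij => ?_
  simp only [Pi.neg_apply]
  ring

theorem IsBound.qbilin_sum_left {a b K : ℝ} (h : IsBound a b K) {ι : Type*} (S : Finset ι)
    {f : ι → Times} {t : Times} (hf : ∀ i, IsTame K (f i)) (ht : IsTame K t) :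
    qbilin a b (∑ i ∈ S, f i) t = ∑ i ∈ S, qbilin a b (f i) t := by
  classical
  induction S using Finset.induction_on with
  | empty => simp [qbilin]
  | insert i S hi ih =>
    rw [sum_insert hi, sum_insert hi,
      h.qbilin_add_left (hf i) (isTame_sum h.pos.le S hf) ht, ih]

theorem IsBound.qform_sub_sum {a b K : ℝ} (h : IsBound a b K) {ι : Type*} (S : Finset ι)
    {f : ι → Times} {t : Times} (hf : ∀ i, IsTame K (f i)) (ht : IsTame K t) :
    qform a b (t - ∑ i ∈ S, f i) = qform a b t - 2 * ∑ i ∈ S, qbilin a b t (f i) +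
      ∑ i ∈ S, ∑ j ∈ S, qbilin a b (f i) (f j) := by
  have hs := isTame_sum h.pos.le S hf
  have hd : IsTame K (t + -∑ i ∈ S, f i) := ht.add h.pos.le hs.neg
  rw [qform_eq_qbilin, qform_eq_qbilin, sub_eq_add_neg, h.qbilin_add_left ht hs.neg hd,
    qbilin_symm a b t, h.qbilin_add_left ht hs.neg ht, qbilin_neg_left, qbilin_neg_left,
    qbilin_symm a b (∑ i ∈ S, f i) (t + _), h.qbilin_add_left ht hs.neg hs, qbilin_neg_left,
    qbilin_symm a b t, h.qbilin_sum_left S hf ht, h.qbilin_sum_left S hf hs]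
  have e1 : ∀ i, qbilin a b (f i) t = qbilin a b t (f i) := fun i => qbilin_symm _ _ _ _
  have e2 : ∀ i, qbilin a b (f i) (∑ j ∈ S, f j) = ∑ j ∈ S, qbilin a b (f i) (f j) := fun i => by
    rw [qbilin_symm, h.qbilin_sum_left S hf (hf i)]
    exact sum_congr rfl fun j _ => qbilin_symm _ _ _ _
  have e3 : qbilin a b t (∑ i ∈ S, f i) = ∑ i ∈ S, qbilin a b t (f i) := by
    rw [qbilin_symm, h.qbilin_sum_left S hf ht]
    exact sum_congr rfl fun i _ => e1 i
  simp only [e1, e2, e3]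
  ring

/-! ### Taylor expansions -/

theorem hasSum_taylor_pnat {f : ℂ → ℂ} {c z : ℂ} {r : ℝ}
    (hf : DifferentiableOn ℂ f (Metric.ball c r)) (hz : ‖z‖ < r) :
    HasSum (fun k : ℕ+ => ((k : ℕ).factorial : ℂ)⁻¹ * z ^ (k : ℕ) * iteratedDeriv k f c)
      (f (c + z) - f c) := by
  have h := Complex.hasSum_taylorSeries_on_ball hf (z := c + z) (by simpa using hz)
  rw [hasSum_pnat_iff (f := fun k : ℕ => (k.factorial : ℂ)⁻¹ * z ^ k * iteratedDeriv k f c)]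
  simp only [add_sub_cancel_left, smul_eq_mul, ← mul_assoc] at h
  simpa using h

section

variable {a b K : ℝ} (ha : 0 < a) (hb : 0 < b) (h : IsBound a b K)

include ha hb h

theorem IsBound.differentiableOn_iteratedDeriv (n : ℕ) {c : ℂ} {r : ℝ} (hr : ‖c‖ + r ≤ 2 / K) :
    DifferentiableOn ℂ (iteratedDeriv n (logDerivQuot a b)) (Metric.ball c r) := by
  refine (differentiableOn_iteratedDeriv_logDerivQuot ha hb n).mono fun u hu => h.ne_zero u ?_
  have h1 : ‖u - c‖ < r := by simpa [dist_eq_norm] using hu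
  have h2 : ‖u‖ ≤ ‖u - c‖ + ‖c‖ := by simpa using norm_add_le (u - c) c
  linarith

/-- The division by `j` in `[w]` turns `1/(j-1)!` into `1/j!`, so the sum is the Taylor series at
`0` of a derivative of `logDerivQuot` without its constant term. -/
theorem IsBound.hasSum_qcoef_miwa (i : ℕ+) {w : ℂ} (hw : ‖w‖ < 1 / K) :
    HasSum (fun j : ℕ+ => qcoef a b i j * miwa w j) (regCoef a b i 0 - regCoef a b i w) := by
  have hK := h.pos
  have h2 : (1 : ℝ) / K < 2 / K := by gcongr; norm_num
  have h1 := hasSum_taylor_pnat (h.differentiableOn_iteratedDeriv ha hb ((i : ℕ) - 1)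
    (c := 0) (r := 2 / K) (by simp)) (hw.trans h2)
  simp only [zero_add, iteratedDeriv_add_index] at h1
  have h3 := h1.mul_left (-((-1) ^ ((i : ℕ) - 1) / (((i : ℕ) - 1).factorial : ℂ)))
  rw [regCoef, regCoef]
  convert! h3 using 1
  · funext j
    obtain ⟨n, hn⟩ : ∃ n, (j : ℕ) = n + 1 := ⟨j - 1, (Nat.sub_add_cancel j.pos).symm⟩
    rw [qcoef_eq, miwa, hn, Nat.add_sub_cancel, Nat.factorial_succ,
      add_comm (n + 1) ((i : ℕ) - 1)]
    have e1 : (n.factorial : ℂ) ≠ 0 := by exact_mod_cast n.factorial_ne_zero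
    have e2 : (((i : ℕ) - 1).factorial : ℂ) ≠ 0 := by exact_mod_cast Nat.factorial_ne_zero _
    have e3 : ((n + 1 : ℕ) : ℂ) ≠ 0 := by exact_mod_cast n.succ_ne_zero
    rw [Nat.cast_mul]
    field_simp
  · ring

theorem IsBound.hasSum_qbilin_miwa {t : Times} (ht : IsTame K t) {w : ℂ} (hw : ‖w‖ < 1 / K) :
    HasSum (fun i : ℕ+ => t i * (regCoef a b i 0 - regCoef a b i w)) (qbilin a b t (miwa w)) := by
  refine (h.summable ht (isTame_miwa h.pos hw)).hasSum.prod_fiberwise fun i => ?_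
  have := (h.hasSum_qcoef_miwa ha hb i hw).mul_left (t i)
  refine this.congr_fun ?_ |> fun h => h
  intro j
  ring

/-- A logarithm of `θ₁₁(u / 2ω₁) / u` near the origin. -/
theorem IsBound.exists_log : ∃ Λ : ℂ → ℂ, (∀ u, ‖u‖ < 2 / K → HasDerivAt Λ (logDerivQuot a b u) u) ∧
    (∀ u, ‖u‖ < 2 / K → Complex.exp (Λ u) = thetaQuot a b u) ∧
    (∀ u, ‖u‖ < 2 / K → Λ (-u) = Λ u) := by
  have hK := h.pos
  have hd := h.differentiableOn_iteratedDeriv ha hb 0 (c := 0) (r := 2 / K) (by simp)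
  rw [iteratedDeriv_zero] at hd
  obtain ⟨Λ, hΛ0, hΛ⟩ := hd.isExactOn_ball.with_val_at 0 (Complex.log (thetaQuot a b 0))
  have hΛ' : ∀ u, ‖u‖ < 2 / K → HasDerivAt Λ (logDerivQuot a b u) u := fun u hu =>
    hΛ u (by simpa using hu)
  have h0 : (0 : ℂ) ∈ Metric.ball (0 : ℂ) (2 / K) := Metric.mem_ball_self (by positivity)
  have hpre : IsPreconnected (Metric.ball (0 : ℂ) (2 / K)) :=
    (convex_ball _ _).isPreconnected
  have hE := differentiable_thetaQuot ha hb
  refine ⟨Λ, hΛ', fun u hu => ?_, fun u hu => ?_⟩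
  -- `e^{-Λ} E` has derivative zero and equals `1` at the centre; evenness follows likewise, from
  -- the oddness of `logDerivQuot`.
  · have hD : ∀ x ∈ Metric.ball (0 : ℂ) (2 / K), HasDerivAt
        (fun x => Complex.exp (-Λ x) * thetaQuot a b x) 0 x := by
      intro x hx
      have hx' : ‖x‖ < 2 / K := by simpa using hx
      have h1 := ((hΛ' x hx').neg.cexp).mul (hE x).hasDerivAt
      convert! h1 using 1
      rw [logDerivQuot, logDeriv_apply]
      have := h.ne_zero x hx'
      simp only [Pi.neg_apply]
      field_simp
      ring
    have h1 := Metric.isOpen_ball.is_const_of_deriv_eq_zero hpre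
      (fun x hx => (hD x hx).differentiableAt.differentiableWithinAt)
      (fun x hx => (hD x hx).deriv) (x := u) (y := 0) (by simpa using hu) h0
    have h2 : thetaQuot a b 0 ≠ 0 := h.ne_zero 0 (by simpa using h0)
    simp only [hΛ0, Complex.exp_neg, Complex.exp_log h2, inv_mul_cancel₀ h2] at h1
    rw [inv_mul_eq_one₀ (Complex.exp_ne_zero _)] at h1
    exact h1
  · have hD : ∀ x ∈ Metric.ball (0 : ℂ) (2 / K), HasDerivAt (fun x => Λ (-x) - Λ x) 0 x := by
      intro x hx
      have hx' : ‖x‖ < 2 / K := by simpa using hx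
      have h1 := (hΛ' (-x) (by simpa using hx')).comp x (hasDerivAt_neg x)
      convert! h1.sub (hΛ' x hx') using 1
      rw [logDerivQuot_neg]
      ring
    have h1 := Metric.isOpen_ball.is_const_of_deriv_eq_zero hpre
      (fun x hx => (hD x hx).differentiableAt.differentiableWithinAt)
      (fun x hx => (hD x hx).deriv) (x := u) (y := 0) (by simpa using hu) h0
    simpa [sub_eq_zero] using h1

/-- Taylor expansion of `Λ` with increment `-z` about the centres `0` and `w`. Points up to `‖z‖ +
‖w‖ < 2/K` occur, which explains the radius in `IsBound`. -/
theorem IsBound.qbilin_miwa_miwa {Λ : ℂ → ℂ}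
    (hΛ : ∀ u, ‖u‖ < 2 / K → HasDerivAt Λ (logDerivQuot a b u) u) {z w : ℂ}
    (hz : ‖z‖ < 1 / K) (hw : ‖w‖ < 1 / K) :
    qbilin a b (miwa z) (miwa w) = Λ 0 - Λ (-z) - Λ w + Λ (w - z) := by
  have hK := h.pos
  have key : ∀ c : ℂ, ‖c‖ < 1 / K →
      HasSum (fun i : ℕ+ => miwa z i * regCoef a b i c) (Λ c - Λ (c - z)) := by
    intro c hc
    have h2 : (2 : ℝ) / K = 1 / K + 1 / K := by ring
    have hmem : ∀ u ∈ Metric.ball c (1 / K), ‖u‖ < 2 / K := by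
      intro u hu
      have h1 : ‖u - c‖ < 1 / K := by simpa [dist_eq_norm] using hu
      have h3 : ‖u‖ ≤ ‖u - c‖ + ‖c‖ := by simpa using norm_add_le (u - c) c
      linarith
    have h1 := hasSum_taylor_pnat (f := Λ) (c := c) (z := -z) (r := 1 / K)
      (fun u hu => (hΛ u (hmem u hu)).differentiableAt.differentiableWithinAt) (by simpa using hz)
    have h3 := h1.neg
    rw [← sub_eq_add_neg, neg_sub] at h3
    convert! h3 using 1
    funext i
    obtain ⟨n, hn⟩ : ∃ n, (i : ℕ) = n + 1 := ⟨i - 1, (Nat.sub_add_cancel i.pos).symm⟩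
    have hev : deriv Λ =ᶠ[𝓝 c] logDerivQuot a b := by
      filter_upwards [Metric.ball_mem_nhds c (by positivity : 0 < 1 / K)] with u hu
      exact (hΛ u (hmem u hu)).deriv
    rw [miwa, regCoef, hn, Nat.add_sub_cancel, iteratedDeriv_succ', hev.iteratedDeriv_eq,
      Nat.factorial_succ, neg_pow z, Nat.cast_mul]
    have e1 : (n.factorial : ℂ) ≠ 0 := by exact_mod_cast n.factorial_ne_zero
    have e3 : ((n + 1 : ℕ) : ℂ) ≠ 0 := by exact_mod_cast n.succ_ne_zero
    field_simp
    ring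
  have h1 := (key 0 (by simpa using hK)).sub (key w hw)
  have h2 := h.hasSum_qbilin_miwa ha hb (isTame_miwa hK hz) hw
  have h3 := h2.unique (h1.congr_fun (fun i => by ring) |> fun h => h)
  rw [h3, zero_sub]
  ring

theorem IsBound.exp_qbilin_miwa {z w : ℂ} (hz : ‖z‖ < 1 / K) (hw : ‖w‖ < 1 / K) :
    Complex.exp (qbilin a b (miwa z) (miwa w)) =
      thetaQuot a b (w - z) * thetaQuot a b 0 / (thetaQuot a b z * thetaQuot a b w) := by
  have hK := h.pos
  have h2 : (2 : ℝ) / K = 1 / K + 1 / K := by ring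
  have hK' : 0 < 1 / K := by positivity
  obtain ⟨Λ, h1, hexp, heven⟩ := h.exists_log ha hb
  have hwz : ‖w - z‖ < 2 / K := (norm_sub_le w z).trans_lt (by linarith)
  rw [h.qbilin_miwa_miwa ha hb h1 hz hw, heven z (by linarith), Complex.exp_add, Complex.exp_sub,
    Complex.exp_sub, hexp _ hwz, hexp z (by linarith), hexp w (by linarith),
    hexp 0 (by rw [norm_zero]; linarith)]
  field_simp

/-- On the diagonal the form is `2(Λ 0 - Λ z)` because `Λ` is even. Working with `Λ` avoids the sign
ambiguity of a square root of `exp_qbilin_miwa`. -/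
theorem IsBound.exp_half_qbilin_miwa {z : ℂ} (hz : ‖z‖ < 1 / K) :
    Complex.exp (qbilin a b (miwa z) (miwa z) / 2) = thetaQuot a b 0 / thetaQuot a b z := by
  have hK := h.pos
  have h2 : (2 : ℝ) / K = 1 / K + 1 / K := by ring
  have hK' : 0 < 1 / K := by positivity
  obtain ⟨Λ, h1, hexp, heven⟩ := h.exists_log ha hb
  rw [h.qbilin_miwa_miwa ha hb h1 hz hz, heven z (by linarith), sub_self,
    show (Λ 0 - Λ z - Λ z + Λ 0) / 2 = Λ 0 - Λ z by ring, Complex.exp_sub,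
    hexp z (by linarith), hexp 0 (by rw [norm_zero]; linarith)]

end

/-- A double sum over a symmetric array. -/
theorem sum_sum_symm {N : ℕ} (f : Fin N → Fin N → ℂ) (hf : ∀ i j, f i j = f j i) :
    ∑ i, ∑ j, f i j = ∑ i, f i i + 2 * ∑ i, ∑ j ∈ Ioi i, f i j := by
  have h := sum_sum_Ioi_add_eq_sum_sum_off_diag f
  have h1 : ∀ i, ∑ j, f i j = f i i + ∑ j ∈ {i}ᶜ, f j i := fun i => by
    rw [← sum_add_sum_compl {i}, sum_singleton]
    congr 1
    exact sum_congr rfl fun j _ => hf i j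
  rw [sum_congr rfl fun i _ => h1 i, sum_add_distrib, ← h, mul_sum]
  congr 1
  refine sum_congr rfl fun i _ => ?_
  rw [mul_sum]
  refine sum_congr rfl fun j _ => ?_
  rw [hf j i]
  ring

/-- The prime form factor `∏_{r<s} E(x_s - x_r) E(0) / ∏_r E(x_r)^N` with `E = thetaQuot`. -/
noncomputable def primeFactor (a b : ℝ) {N : ℕ} (x : Fin N → ℂ) : ℂ :=
  (∏ r, thetaQuot a b 0 / thetaQuot a b (x r)) *
    ∏ r, ∏ s ∈ Ioi r, thetaQuot a b (x s - x r) * thetaQuot a b 0 /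
      (thetaQuot a b (x r) * thetaQuot a b (x s))

/-- Expand the quadratic form: cross terms with `t` give the linear exponential, diagonal terms and
pairs of shifts give `primeFactor`. -/
theorem IsBound.tauSeries_sub_sum {a b K : ℝ} (ha : 0 < a) (hb : 0 < b) (h : IsBound a b K)
    (e : ℂ) {N : ℕ} {t : Times} (ht : IsTame K t) {x : Fin N → ℂ} (hx : ∀ r, ‖x r‖ < 1 / K) :
    tauSeries a b e (t - ∑ r, miwa (x r)) =
      Complex.exp (qform a b t / 2) *
        Complex.exp (∑ r, ∑' k : ℕ+, t k * (regCoef a b k (x r) - regCoef a b k 0)) *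
        primeFactor a b x * theta a b ((t 1 - ∑ r, x r) / twoω₁ b + e) := by
  have h1 := h.qform_sub_sum univ (f := fun r => miwa (x r))
    (fun r => isTame_miwa h.pos (hx r)) ht
  have h2 : ∀ r, qbilin a b t (miwa (x r)) =
      -∑' k : ℕ+, t k * (regCoef a b k (x r) - regCoef a b k 0) := fun r => by
    rw [← (h.hasSum_qbilin_miwa ha hb ht (hx r)).tsum_eq, ← tsum_neg]
    exact tsum_congr fun k => by ring
  have h3 : (t - ∑ r, miwa (x r)) 1 = t 1 - ∑ r, x r := by
    simp [miwa]
  rw [tauSeries, h1, h3, sum_sum_symm _ fun r s => qbilin_symm _ _ _ _]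
  simp only [h2, sum_neg_distrib]
  have hA := fun r => h.exp_half_qbilin_miwa ha hb (hx r)
  have hB := fun r s => h.exp_qbilin_miwa ha hb (hx r) (hx s)
  rw [show ∀ A B C D : ℂ, (A - 2 * -B + (C + 2 * D)) / 2 = A / 2 + B + (C / 2 + D) from
    fun _ _ _ _ => by ring, Complex.exp_add, Complex.exp_add, Complex.exp_add, sum_div]
  simp only [Complex.exp_sum, hA, hB, primeFactor]

/-! ### The value of the seed at shifted times -/

theorem dilate_one (t : Times) : dilate 1 t = t := by
  funext k
  simp [dilate]

theorem dilate_sub_sum_miwa (l : ℂ) (t : Times) {N : ℕ} (x : Fin N → ℂ) :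
    dilate l (t - ∑ r, miwa (x r)) = dilate l t - ∑ r, miwa (l * x r) := by
  funext k
  simp only [dilate, Pi.sub_apply, Finset.sum_apply, miwa, mul_sub, mul_sum, mul_pow]
  congr 1
  exact sum_congr rfl fun r _ => by ring

theorem IsEntireTimes.dilate {t : Times} (ht : IsEntireTimes t) (l : ℂ) :
    IsEntireTimes (dilate l t) := by
  intro r
  refine (ht (‖l‖ * r)).congr fun k => ?_
  rw [EllipticKP.dilate, norm_mul, norm_pow, mul_pow]
  ring

/-- The zeros of a nonzero entire function form a discrete set, and a discrete subset of the plane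
is countable by the Lindelöf property. -/
theorem countable_zeros {f : ℂ → ℂ} (hf : Differentiable ℂ f) (h0 : f 0 ≠ 0) :
    {l | f l = 0}.Countable := by
  have h1 : AnalyticOnNhd ℂ f Set.univ := fun z _ => hf.analyticAt z
  have h2 := mem_codiscrete'.1 (h1.preimage_zero_mem_codiscrete h0)
  have h3 : (f ⁻¹' {0}ᶜ)ᶜ = {l | f l = 0} := by
    ext l
    simp
  rw [h3] at h2
  exact (HereditarilyLindelofSpace.isLindelof _).countable_of_isDiscrete h2.2

section

variable {a b : ℝ} (ha : 0 < a) (hb : 0 < b)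

include ha hb

theorem summable_mul_regCoef {t : Times} (ht : IsEntireTimes t) {w : ℂ}
    (hw : thetaQuot a b w ≠ 0) : Summable fun k : ℕ+ => t k * regCoef a b k w := by
  obtain ⟨δ, hδ, C, hC, ρ, hρ, h⟩ := exists_norm_regCoef_le ha hb hw
  refine Summable.of_norm_bounded ((ht ρ).mul_left C) fun k => ?_
  rw [norm_mul]
  calc ‖t k‖ * ‖regCoef a b k w‖ ≤ ‖t k‖ * (C * ρ ^ (k : ℕ)) := by
        gcongr
        exact (h w (Metric.mem_ball_self hδ)).2 k
    _ = _ := by ring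

theorem differentiable_qform_dilate {t : Times} (ht : IsEntireTimes t) :
    Differentiable ℂ fun l => qform a b (dilate l t) := by
  obtain ⟨K, h⟩ := exists_isBound ha hb
  intro l₀
  set R : ℝ := ‖l₀‖ + 1
  have hR : 0 < R := by positivity
  have hs := (h.summable ((ht.dilate (R : ℂ)).isTame K) ((ht.dilate (R : ℂ)).isTame K)).norm
  have hd : DifferentiableOn ℂ (fun l => qform a b (dilate l t)) (Metric.ball (0 : ℂ) R) := by
    refine Complex.differentiableOn_tsum_of_summable_norm hs (fun ij => ?_) Metric.isOpen_ball
      fun ij l hl => ?_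
    · simp only [dilate]
      fun_prop
    · have hl' : ‖l‖ ≤ ‖(R : ℂ)‖ := by
        rw [Complex.norm_real, Real.norm_of_nonneg hR.le]
        simpa using (mem_ball_zero_iff.1 hl).le
      simp only [dilate, norm_mul, norm_pow]
      gcongr
  exact hd.differentiableAt (Metric.isOpen_ball.mem_nhds (by simp [R]))

theorem differentiableAt_tsum_regCoef {t : Times} (ht : IsEntireTimes t) {x l₀ : ℂ}
    (hx : thetaQuot a b (l₀ * x) ≠ 0) :
    DifferentiableAt ℂ (fun l => ∑' k : ℕ+, dilate l t k *
      (regCoef a b k (l * x) - regCoef a b k 0)) l₀ := by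
  obtain ⟨δ, hδ, C, hC, ρ, hρ, h⟩ := exists_norm_regCoef_le ha hb hx
  obtain ⟨δ', hδ', C', hC', ρ', hρ', h'⟩ := exists_norm_regCoef_le ha hb
    (thetaQuot_zero_ne_zero ha hb)
  have hcont : Continuous fun l : ℂ => l * x := by fun_prop
  set R : ℝ := ‖l₀‖ + 1 with hRdef
  set U : Set ℂ := (fun l => l * x) ⁻¹' Metric.ball (l₀ * x) δ ∩ Metric.ball 0 R with hU
  have hUo : IsOpen U := (Metric.isOpen_ball.preimage hcont).inter Metric.isOpen_ball
  have hmem : l₀ ∈ U := ⟨Metric.mem_ball_self hδ, by simp [R]⟩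
  have hs : Summable fun k : ℕ+ => C * (‖t k‖ * (R * ρ) ^ (k : ℕ)) +
      C' * (‖t k‖ * (R * ρ') ^ (k : ℕ)) :=
    ((ht (R * ρ)).mul_left C).add ((ht (R * ρ')).mul_left C')
  have hd : DifferentiableOn ℂ (fun l => ∑' k : ℕ+, dilate l t k *
      (regCoef a b k (l * x) - regCoef a b k 0)) U := by
    refine Complex.differentiableOn_tsum_of_summable_norm hs (fun k => ?_) hUo fun k l hl => ?_
    · have h1 : DifferentiableOn ℂ (fun l : ℂ => regCoef a b k (l * x)) U := by
        unfold regCoef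
        refine DifferentiableOn.const_mul ?_ _
        refine (differentiableOn_iteratedDeriv_logDerivQuot ha hb _).comp
          (f := fun l : ℂ => l * x) (by fun_prop) fun l hl => ?_
        exact (h _ hl.1).1
      have h2 : DifferentiableOn ℂ (fun l : ℂ => dilate l t k) U := by
        simp only [dilate]
        fun_prop
      exact h2.mul (h1.sub_const _)
    · have hl' : ‖l‖ ≤ R := by simpa using (mem_ball_zero_iff.1 hl.2).le
      rw [norm_mul, dilate, norm_mul, norm_pow]
      have hR : 0 < R := by positivity
      calc ‖l‖ ^ (k : ℕ) * ‖t k‖ * ‖regCoef a b k (l * x) - regCoef a b k 0‖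
          ≤ R ^ (k : ℕ) * ‖t k‖ * (C * ρ ^ (k : ℕ) + C' * ρ' ^ (k : ℕ)) := by
            gcongr
            exact (norm_sub_le _ _).trans
              (add_le_add ((h _ hl.1).2 k) ((h' _ (Metric.mem_ball_self hδ')).2 k))
        _ = _ := by
            rw [mul_pow, mul_pow]
            ring
  exact hd.differentiableAt (hUo.mem_nhds hmem)

theorem differentiableAt_primeFactor {N : ℕ} {x : Fin N → ℂ} {l₀ : ℂ}
    (hx : ∀ r, thetaQuot a b (l₀ * x r) ≠ 0) :
    DifferentiableAt ℂ (fun l => primeFactor a b fun r => l * x r) l₀ := by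
  have hE : ∀ c : ℂ, DifferentiableAt ℂ (fun l => thetaQuot a b (l * c)) l₀ := fun c =>
    ((differentiable_thetaQuot ha hb).comp (f := fun l : ℂ => l * c) (by fun_prop)) l₀
  unfold primeFactor
  refine DifferentiableAt.mul ?_ ?_
  · refine DifferentiableAt.fun_finsetProd fun r _ => ?_
    exact (differentiableAt_const _).div (hE _) (hx r)
  · refine DifferentiableAt.fun_finsetProd fun r _ => DifferentiableAt.fun_finsetProd fun s _ => ?_
    simp only [← mul_sub]
    exact ((hE _).mul_const _).div ((hE _).mul (hE _)) (mul_ne_zero (hx r) (hx s))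

/-- The analytic continuation of the seed at `t - ∑ [x_r]`. -/
theorem isTauValue_sub_sum (e : ℂ) {N : ℕ} {t : Times} (ht : IsEntireTimes t) {x : Fin N → ℂ}
    (hx : ∀ r, thetaQuot a b (x r) ≠ 0) :
    IsTauValue a b e (t - ∑ r, miwa (x r))
      (Complex.exp (qform a b t / 2) *
        Complex.exp (∑ r, ∑' k : ℕ+, t k * (regCoef a b k (x r) - regCoef a b k 0)) *
        primeFactor a b x * theta a b ((t 1 - ∑ r, x r) / twoω₁ b + e)) := by
  obtain ⟨K, h⟩ := exists_isBound ha hb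
  have hE : ∀ c : ℂ, Differentiable ℂ (fun l => thetaQuot a b (l * c)) := fun c =>
    (differentiable_thetaQuot ha hb).comp (f := fun l : ℂ => l * c) (by fun_prop)
  have h0 := thetaQuot_zero_ne_zero ha hb
  -- The only possible singularities in `λ`: zeros of the denominators `E(λ x_r)`. The point `1` is
  -- excluded by `hx`, and `0` by `E(0) ≠ 0`.
  set S : Set ℂ := ⋃ r, {l | thetaQuot a b (l * x r) = 0} with hS
  have hSc : IsClosed S := isClosed_iUnion_of_finite fun r =>
    isClosed_eq (hE (x r)).continuous continuous_const
  refine ⟨2, S, fun l => Complex.exp (qform a b (dilate l t) / 2) *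
    Complex.exp (∑ r, ∑' k : ℕ+, dilate l t k * (regCoef a b k (l * x r) - regCoef a b k 0)) *
    (primeFactor a b fun r => l * x r) *
    theta a b ((dilate l t 1 - ∑ r, l * x r) / twoω₁ b + e), by norm_num,
    Set.countable_iUnion fun r => countable_zeros (hE (x r)) (by simpa using h0), by simp [S, h0],
    by simpa [S] using hx, Metric.isOpen_ball.sdiff hSc, ?_, ?_, ?_⟩
  · rintro l ⟨-, hl⟩
    have hl' : ∀ r, thetaQuot a b (l * x r) ≠ 0 := by simpa [S] using hl
    refine DifferentiableAt.differentiableWithinAt ?_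
    refine DifferentiableAt.mul (DifferentiableAt.mul (DifferentiableAt.mul ?_ ?_) ?_) ?_
    · exact ((differentiable_qform_dilate ha hb ht l).div_const 2).cexp
    · refine DifferentiableAt.cexp (DifferentiableAt.fun_sum fun r _ => ?_)
      exact differentiableAt_tsum_regCoef ha hb ht (hl' r)
    · exact differentiableAt_primeFactor ha hb hl'
    · refine ((differentiable_theta ha hb).comp
        (f := fun l => (dilate l t 1 - ∑ r, l * x r) / twoω₁ b + e) ?_) l
      simp only [dilate]
      fun_prop
  -- For `λ` near `0` all `λ x_r` are small enough for the convergent series expression.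
  · have hK : 0 < 1 / K := one_div_pos.2 h.pos
    have hev : ∀ᶠ l in 𝓝 (0 : ℂ), ∀ r, ‖l * x r‖ < 1 / K := by
      rw [eventually_all]
      intro r
      have hc : Continuous fun l : ℂ => ‖l * x r‖ := by fun_prop
      exact hc.continuousAt.eventually_lt continuousAt_const (by simpa using h.pos)
    filter_upwards [hev] with l hl
    have ht' := (ht.dilate l).isTame K
    rw [dilate_sub_sum_miwa]
    refine ⟨?_, (h.tauSeries_sub_sum ha hb e ht' hl).symm⟩
    have htame : IsTame K (dilate l t - ∑ r, miwa (l * x r)) := by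
      rw [sub_eq_add_neg]
      exact ht'.add h.pos.le (isTame_sum h.pos.le _ fun r => isTame_miwa h.pos (hl r)).neg
    exact h.summable htame htame
  · simp only [dilate_one, one_mul]

/-! ### The coefficients of the logarithmic derivative of `θ₁₁` -/

/-- The logarithmic derivative of `u E(u)` is `1/u + L(u)`; the normalisation of `F_k` sends the
pole part to exactly `p^{-k}`. -/
theorem Fcoef_eq {p : ℂ} (hp : theta11 a b (p / twoω₁ b) ≠ 0) (k : ℕ+) :
    Fcoef a b k p = regCoef a b k p + p⁻¹ ^ (k : ℕ) := by
  have hp0 := ne_zero_of_theta11_ne_zero hp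
  have hE := thetaQuot_ne_zero hp
  have hd := differentiable_thetaQuot ha hb
  have hopen := isOpen_thetaQuot_ne_zero ha hb
  obtain ⟨n, hn⟩ : ∃ n, (k : ℕ) = n + 1 := ⟨k - 1, (Nat.sub_add_cancel k.pos).symm⟩
  have hev : dlogTheta a b =ᶠ[𝓝 p] Inv.inv + logDerivQuot a b := by
    filter_upwards [hopen.mem_nhds hE, isOpen_ne.mem_nhds hp0] with z hz hz0
    have hf : (fun w => theta11 a b (w / twoω₁ b)) = fun w => w * thetaQuot a b w :=
      funext fun w => (mul_thetaQuot a b w).symm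
    rw [dlogTheta, hf, logDeriv_mul z hz0 hz differentiableAt_fun_id (hd z)]
    simp [logDerivQuot, logDeriv_apply]
  have han : AnalyticAt ℂ (logDerivQuot a b) p :=
    (differentiableOn_logDerivQuot ha hb).analyticAt (hopen.mem_nhds hE)
  have e1 : (n.factorial : ℂ) ≠ 0 := by exact_mod_cast n.factorial_ne_zero
  rw [Fcoef, regCoef, hn, Nat.add_sub_cancel, hev.iteratedDeriv_eq,
    iteratedDeriv_add (contDiffAt_inv ℂ hp0) han.contDiffAt, iteratedDeriv_eq_iterate (f := Inv.inv),
    iter_deriv_inv, mul_add, add_comm]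
  congr 1
  have e2 : (p : ℂ) ^ (-1 - n : ℤ) = p⁻¹ ^ (n + 1) := by
    rw [show (-1 - n : ℤ) = -((n + 1 : ℕ) : ℤ) by push_cast; ring, zpow_neg, zpow_natCast, inv_pow]
  have e3 : ((-1 : ℂ) ^ n) * (-1) ^ n = 1 := by
    rw [← pow_add, ← two_mul, pow_mul]
    simp
  rw [e2]
  field_simp
  linear_combination e3

theorem summable_mul_Fcoef {t : Times} (ht : IsEntireTimes t) {p : ℂ}
    (hp : theta11 a b (p / twoω₁ b) ≠ 0) : Summable fun k : ℕ+ => t k * Fcoef a b k p := by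
  refine ((summable_mul_regCoef ha hb ht (thetaQuot_ne_zero hp)).add
    (ht.summable_eta p⁻¹)).congr fun k => ?_
  rw [Fcoef_eq ha hb hp]
  ring

theorem tsum_regCoef_sub {t : Times} (ht : IsEntireTimes t) {p : ℂ}
    (hp : theta11 a b (p / twoω₁ b) ≠ 0) :
    ∑' k : ℕ+, t k * (regCoef a b k p - regCoef a b k 0) =
      ∑' k : ℕ+, t k * Fcoef a b k p - eta t p⁻¹ - ∑' k : ℕ+, t k * regCoef a b k 0 := by
  have h1 := (summable_mul_Fcoef ha hb ht hp).hasSum.sub (ht.summable_eta p⁻¹).hasSum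
  have h2 := h1.sub (summable_mul_regCoef ha hb ht (thetaQuot_zero_ne_zero ha hb)).hasSum
  rw [eta, ← h2.tsum_eq]
  refine tsum_congr fun k => ?_
  rw [Fcoef_eq ha hb hp]
  ring

end

/-- The constant `c`. -/
noncomputable def tauConst (a b : ℝ) (N : ℕ) : ℂ :=
  (∏ _r : Fin N, thetaQuot a b 0) * ∏ r : Fin N, ∏ _s ∈ Ioi r, -thetaQuot a b 0

theorem tauConst_ne_zero {a b : ℝ} (ha : 0 < a) (hb : 0 < b) (N : ℕ) : tauConst a b N ≠ 0 := by
  have h := thetaQuot_zero_ne_zero ha hb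
  exact mul_ne_zero (prod_ne_zero_iff.2 fun _ _ => h)
    (prod_ne_zero_iff.2 fun _ _ => prod_ne_zero_iff.2 fun _ _ => neg_ne_zero.2 h)

/-- Since `1/x_s - 1/x_r = -(x_s - x_r)/(x_r x_s)`, the Vandermonde factors supply the linear
factors that complete each `E` to a `θ₁₁`. -/
theorem vdm_inv_mul_primeFactor {a b : ℝ} {N : ℕ} {x : Fin N → ℂ}
    (hx : ∀ r, theta11 a b (x r / twoω₁ b) ≠ 0) :
    vdm (fun r => (x r)⁻¹) * primeFactor a b x = tauConst a b N *
      ((∏ r, x r / theta11 a b (x r / twoω₁ b) ^ N) *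
        ∏ r, ∏ s ∈ Ioi r, theta11 a b ((x s - x r) / twoω₁ b)) := by
  have hx0 : ∀ r, x r ≠ 0 := fun r => ne_zero_of_theta11_ne_zero (hx r)
  have hE : ∀ r, thetaQuot a b (x r) ≠ 0 := fun r => thetaQuot_ne_zero (hx r)
  have h1 : ∀ r, thetaQuot a b 0 / thetaQuot a b (x r) =
      thetaQuot a b 0 * (x r / theta11 a b (x r / twoω₁ b)) := fun r => by
    rw [← mul_thetaQuot]
    have := hx0 r
    have := hE r
    field_simp
  have h2 : ∀ r s, ((x s)⁻¹ - (x r)⁻¹) * (thetaQuot a b (x s - x r) * thetaQuot a b 0 /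
      (thetaQuot a b (x r) * thetaQuot a b (x s))) =
      -thetaQuot a b 0 * ((theta11 a b (x r / twoω₁ b))⁻¹ * (theta11 a b (x s / twoω₁ b))⁻¹) *
        theta11 a b ((x s - x r) / twoω₁ b) := fun r s => by
    rw [← mul_thetaQuot, ← mul_thetaQuot, ← mul_thetaQuot]
    have := hx0 r
    have := hE r
    have := hx0 s
    have := hE s
    field_simp
    ring
  -- Each node lies in `N - 1` pairs; the single factor from `h1` raises the exponent to `N`.
  have h3 : ∏ r, ∏ s ∈ Ioi r,
      ((theta11 a b (x r / twoω₁ b))⁻¹ * (theta11 a b (x s / twoω₁ b))⁻¹) =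
      ∏ r, (theta11 a b (x r / twoω₁ b))⁻¹ ^ (N - 1) := by
    rw [prod_prod_Ioi_mul_eq_prod_prod_off_diag
      (fun s r : Fin N => (theta11 a b (x r / twoω₁ b))⁻¹)]
    refine prod_congr rfl fun r _ => ?_
    rw [prod_const, card_compl, card_singleton, Fintype.card_fin]
  have h4 : ∏ r, x r / theta11 a b (x r / twoω₁ b) ^ N =
      (∏ r, x r / theta11 a b (x r / twoω₁ b)) *
        ∏ r, (theta11 a b (x r / twoω₁ b))⁻¹ ^ (N - 1) := by
    rw [← prod_mul_distrib]
    refine prod_congr rfl fun r _ => ?_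
    rw [← mul_pow_sub_one (Nat.ne_of_gt (Fin.pos r)), inv_pow, div_mul_eq_div_div, div_eq_mul_inv]
  rw [vdm, primeFactor, mul_left_comm]
  simp only [← prod_mul_distrib, h2]
  simp only [h1, prod_mul_distrib, tauConst]
  simp only [prod_mul_distrib] at h3
  rw [h3, h4]
  ring

/-- The term of the dressed tau function belonging to an index set, in closed form. -/
theorem dressedTerm_eq {a b : ℝ} (ha : 0 < a) (hb : 0 < b) (e : ℂ) {N M : ℕ}
    (p : Fin (N + M) → ℂ) (hp : ∀ i, theta11 a b (p i / twoω₁ b) ≠ 0) {t : Times}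
    (ht : IsEntireTimes t) (I : Fin N → Fin (N + M)) :
    dressedTerm a b e p t I = tauConst a b N *
      Complex.exp (∑' k : ℕ+, -(N * regCoef a b k 0) * t k + qform a b t / 2) *
        (Ccoef a b p I * Complex.exp (∑ r, ∑' k : ℕ+, t k * Fcoef a b k (p (I r))) *
          theta a b ((t 1 - ∑ r, p (I r)) / twoω₁ b + e)) := by
  have h1 := (isTauValue_sub_sum ha hb e ht (x := fun r => p (I r))
    fun r => thetaQuot_ne_zero (hp (I r))).tau0_eq
  have h2 := vdm_inv_mul_primeFactor (x := fun r => p (I r)) fun r => hp (I r)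
  have h3 : ∑ r : Fin N, ∑' k : ℕ+, t k * (regCoef a b k (p (I r)) - regCoef a b k 0) =
      ∑ r, (∑' k : ℕ+, t k * Fcoef a b k (p (I r))) - ∑ r, eta t (p (I r))⁻¹ +
        ∑' k : ℕ+, -(N * regCoef a b k 0) * t k := by
    have h4 : ∑' k : ℕ+, -(N * regCoef a b k 0) * t k =
        -(N * ∑' k : ℕ+, t k * regCoef a b k 0) := by
      rw [← tsum_mul_left, ← tsum_neg]
      exact tsum_congr fun k => by ring
    rw [sum_congr rfl fun r _ => tsum_regCoef_sub ha hb ht (hp (I r)), sum_sub_distrib,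
      sum_sub_distrib, sum_const, card_univ, Fintype.card_fin, nsmul_eq_mul, h4]
    ring
  rw [dressedTerm, h1, h3, Complex.exp_add, Complex.exp_add, Complex.exp_sub, Ccoef]
  -- The prefactor `e^{∑ η(t, p⁻¹)}` cancels the pole parts split off from the `F_k`.
  have h5 : Complex.exp (∑ r, eta t (p (I r))⁻¹) *
      (Complex.exp (∑ r, ∑' k : ℕ+, t k * Fcoef a b k (p (I r))) /
        Complex.exp (∑ r, eta t (p (I r))⁻¹)) =
      Complex.exp (∑ r, ∑' k : ℕ+, t k * Fcoef a b k (p (I r))) :=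
    mul_div_cancel₀ _ (Complex.exp_ne_zero _)
  linear_combination vdm (fun r => (p (I r))⁻¹) * Complex.exp (qform a b t / 2) *
    Complex.exp (∑' k : ℕ+, -(N * regCoef a b k 0) * t k) * primeFactor a b (fun r => p (I r)) *
    theta a b ((t 1 - ∑ r, p (I r)) / twoω₁ b + e) * h5 + Complex.exp (qform a b t / 2) *
    Complex.exp (∑ r, ∑' k : ℕ+, t k * Fcoef a b k (p (I r))) *
    Complex.exp (∑' k : ℕ+, -(N * regCoef a b k 0) * t k) *
    theta a b ((t 1 - ∑ r, p (I r)) / twoω₁ b + e) * h2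

end EllipticKP

theorem mainTheorem8 (a b : ℝ) (ha : 0 < a) (hb : 0 < b) (N : ℕ) :
    ∃ (c : ℂ) (cc : ℕ+ → ℂ), c ≠ 0 ∧
      ∀ (M : ℕ) (p : Fin (N + M) → ℂ) (A : Matrix (Fin M) (Fin N) ℂ) (e : ℂ)
        (t : EllipticKP.Times),
        (∀ i, EllipticKP.theta11 a b (p i / EllipticKP.twoω₁ b) ≠ 0) →
        (∀ (i : Fin M) (j : Fin N), EllipticKP.qPart p i ≠ EllipticKP.pPart p j) →
        EllipticKP.IsEntireTimes t →
        -- all the quantities that occur are well defined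
        EllipticKP.QSummable a b t ∧
        EllipticKP.IsTauValue a b e t (EllipticKP.tauSeries a b e t) ∧
        (∀ I ∈ EllipticKP.indexSets N M,
          ∃ v, EllipticKP.IsTauValue a b e (t - ∑ r, EllipticKP.miwa (p (I r))) v) ∧
        Summable (fun j : ℕ+ => cc j * t j) ∧
        (∀ i, Summable fun k : ℕ+ => t k * EllipticKP.Fcoef a b k (p i)) ∧
        -- the formula
        EllipticKP.tauVO a b e p A t =
          c * Complex.exp ((∑' j : ℕ+, cc j * t j) + EllipticKP.qform a b t / 2) *
            ∑ I ∈ EllipticKP.indexSets N M,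
              EllipticKP.minorB p A I * EllipticKP.Ccoef a b p I *
                Complex.exp (∑ r, ∑' k : ℕ+, t k * EllipticKP.Fcoef a b k (p (I r))) *
                EllipticKP.theta a b
                  ((t 1 - ∑ r, p (I r)) / EllipticKP.twoω₁ b + e) := by
  -- Each of the `N` shifts contributes `-regCoef a b k 0` to the coefficient of `t_k`, whatever
  -- node is chosen; hence the dependence on `a`, `b`, `N` only.
  refine ⟨EllipticKP.tauConst a b N, fun k => -(N * EllipticKP.regCoef a b k 0),
    EllipticKP.tauConst_ne_zero ha hb N, fun M p A e t hp hpq ht => ?_⟩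
  obtain ⟨K, hK⟩ := EllipticKP.exists_isBound ha hb
  refine ⟨hK.summable (ht.isTame K) (ht.isTame K), ?_, fun I _ => ?_, ?_, fun i => ?_, ?_⟩
  · refine EllipticKP.isTauValue_tauSeries ha hb e (r := 2) (by norm_num) ?_
    exact hK.summable ((ht.dilate _).isTame K) ((ht.dilate _).isTame K)
  · exact ⟨_, EllipticKP.isTauValue_sub_sum ha hb e ht (x := fun r => p (I r))
      fun r => EllipticKP.thetaQuot_ne_zero (hp (I r))⟩
  · refine ((EllipticKP.summable_mul_regCoef ha hb ht
      (EllipticKP.thetaQuot_zero_ne_zero ha hb)).mul_left (-(N : ℂ))).congr fun k => ?_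
    ring
  · exact EllipticKP.summable_mul_Fcoef ha hb ht (hp i)
  · rw [EllipticKP.tauVO_eq_sum_minorB a b e p A t hpq, mul_sum]
    refine sum_congr rfl fun I _ => ?_
    rw [EllipticKP.dressedTerm_eq ha hb e p hp ht I]
    ring
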